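/- **One-point feedback, randomly initialized LQR.** There is a universal constant $C>0$ such that the following holds. *Setting.* Let $n,m\ge 1$, $A\in\mathbb R^{n\times n}$, $B\in\mathbb R^{n\times m}$, let $Q\in\mathbb R^{n\times n}$, $R\in\mathbb R^{m\times m}$ be symmetric positive definite, and $0<\gamma\le 1$. Let $\nu$ be a probability distribution on $\mathbb R^n$ with $\mathbb E[v]=0$, $\mathbb E[vv^\top]=I$ and $\|v\|_2^2\le C_n$ almost surely for $v\sim\nu$. For a policy $K\in\mathbb R^{m\times n}$ and an initial state $s_0$ let $$\mathcal C(K;s_0)=\sum_{t\ge0}\gamma^t\big(s_t^\top Qs_t+a_t^\top Ra_t\big)\in[0,\infty],\qquad s_{t+1}=As_t+Ba_t,\quad a_t=-Ks_t,\qquad \mathcal C(K)=\mathbb E_{s_0\sim\nu}[\mathcal C(K;s_0)].$$ Let $K_0$ be a policy with $\mathcal C(K_0)<\infty$ and put $D=nm$. Then the set $\{K:\mathcal C(K)<\infty\}$ is open, $\mathcal C$ is continuously differentiable on it, and $\mathcal C$ has a global minimum. Let $K^*$ be any global minimum, $\Delta_0=\mathcal C(K_0)-\mathcal C(K^*)$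 and $\mathcal G=\{K:\mathcal C(K)-\mathcal C(K^*)\le10\Delta_0\}$. *Curvature parameters.* Norms of policies are Frobenius norms. For every policy $K$ of finite cost let $\phi_K,\beta_K,\lambda_K,\zeta_K>0$ be such that $\mathcal C$ is finite on the balls of radius $\beta_K$ and $\zeta_K$ around $K$, $\|\nabla\mathcal C(K')-\nabla\mathcal C(K)\|\le\phi_K\|K'-K\|$ whenever $\|K'-K\|\le\beta_K$, and $|\mathcal C(K')-\mathcal C(K)|\le\lambda_K\|K'-K\|$ whenever $\|K'-K\|\le\zeta_K$. Put $$\phi=\sup_{K\in\mathcal G}\phi_K,\qquad \lambda=\sup_{K\in\mathcal G}\lambda_K,\qquad \rho=\inf_{K\in\mathcal G}\min\{\beta_K,\zeta_K\},\qquad \theta=\min\Big\{\frac1{2\phi},\frac{\rho}{\lambda}\Big\},$$ and let $\mu>0$ satisfy $\|\nabla\mathcal C(K)\|^2\ge\mu(\mathcal C(K)-\mathcal C(K^*))$ for all $K$ of finite cost. Such parameters with $\phi,\lambda<\infty$ and $\rho>0$ exist; fix any such choice. *Algorithm.* Given $\eta,r>0$, the one-point stochastic zero-order method draws in step $t=0,1,\dots$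 independently $s^{(t)}\sim\nu$ and $u_t$ uniform on the unit sphere of $\mathbb R^{m\times n}\cong\mathbb R^D$, observes one rollout cost $\mathcal C(K_t+ru_t;s^{(t)})$, and sets $$K_{t+1}=K_t-\eta\,\frac Dr\,\mathcal C(K_t+ru_t;s^{(t)})\,u_t.$$ *Convergence.* Let $\epsilon,\eta,r>0$ satisfy $$\eta\le C\min\Big\{\frac{\epsilon\mu r^2}{\phi\,C_n^2D^2\,\mathcal C(K_0)^2},\ \frac1\phi,\ \frac{\rho r}{C_nD\,\mathcal C(K_0)}\Big\},\qquad r\le\min\Big\{\frac{\theta\mu}{8\phi}\sqrt{\frac{\epsilon}{15}},\ \frac1{2\phi}\sqrt{\frac{\epsilon\mu}{30}},\ \rho,\ \frac{10\,\mathcal C(K_0)}{\lambda}\Big\}$$ and $\epsilon\log(120\Delta_0/\epsilon)<\frac{10}3\Delta_0$ (which for $\Delta_0=0$ is regarded as not satisfied). Then after $T=\max\{0,\lceil\frac4{\eta\mu}\log(120\Delta_0/\epsilon)\rceil\}$ steps, with probability greater than $3/4$, all $T$ observed costs are finite and $\mathcal C(K_T)-\mathcal C(K^*)\le\epsilon$.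 *Number of rollouts.* There are $a,b,M>0$ not depending on $\epsilon$ such that for every $0<\epsilon\le\Delta_0$ the choice $r=a\sqrt\epsilon$, $\eta=b\epsilon^2$ satisfies the two displayed bounds, and then $T\le M\epsilon^{-2}\log(120\Delta_0/\epsilon)$, that is, $\widetilde O(\epsilon^{-2})$ rollouts. -/

import Mathlib

open MeasureTheory ProbabilityTheory

noncomputable section

namespace LQR

/-- The state space `ℝⁿ` with its Euclidean norm. -/
abbrev State (n : ℕ) : Type := EuclideanSpace ℝ (Fin n)

/-- The space of linear policies `K ∈ ℝ^{m × n}`, regarded as a Euclidean space of dimension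
`D = m * n`; its norm is the Frobenius norm and its inner product the trace inner product. -/
abbrev Policy (n m : ℕ) : Type := EuclideanSpace ℝ (Fin m × Fin n)

/-- The `m × n` matrix of a policy. -/
def Policy.mat {n m : ℕ} (K : Policy n m) : Matrix (Fin m) (Fin n) ℝ :=
  Matrix.of fun i j => K (i, j)

/-- A linear quadratic system with state dimension `n`, control dimension `m`, positive definite
cost matrices and discount factor `0 < γ ≤ 1`. -/
structure System (n m : ℕ) where
  A : Matrix (Fin n) (Fin n) ℝ
  B : Matrix (Fin n) (Fin m) ℝ
  Q : Matrix (Fin n) (Fin n) ℝ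
  R : Matrix (Fin m) (Fin m) ℝ
  γ : ℝ
  posDef_Q : Q.PosDef
  posDef_R : R.PosDef
  γ_pos : 0 < γ
  γ_le_one : γ ≤ 1

variable {n m : ℕ}

/-- The control `a = -K x` that the policy `K` applies in the state `x`. -/
def control (K : Policy n m) (x : Fin n → ℝ) : Fin m → ℝ :=
  -(K.mat.mulVec x)

/-- The noiseless trajectory `x_{t+1} = A x_t + B a_t`, `a_t = -K x_t`, started at `x₀`. -/
def traj (sys : System n m) (K : Policy n m) (x₀ : State n) : ℕ → (Fin n → ℝ)
  | 0 => x₀.ofLp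
  | t + 1 => sys.A.mulVec (traj sys K x₀ t) + sys.B.mulVec (control K (traj sys K x₀ t))

/-- The stage cost `xᵀ Q x + aᵀ R a`. -/
def stageCost (sys : System n m) (x : Fin n → ℝ) (a : Fin m → ℝ) : ℝ :=
  x ⬝ᵥ sys.Q.mulVec x + a ⬝ᵥ sys.R.mulVec a

/-- The sample cost `C(K; x₀) = ∑ₜ γᵗ (xₜᵀ Q xₜ + aₜᵀ R aₜ) ∈ [0, ∞]` of one rollout of `K`. -/
def sampleCost (sys : System n m) (K : Policy n m) (x₀ : State n) : ENNReal :=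
  ∑' t : ℕ, ENNReal.ofReal
    (sys.γ ^ t * stageCost sys (traj sys K x₀ t) (control K (traj sys K x₀ t)))

/-- The population cost `C(K) = E_{x₀ ∼ ν} C(K; x₀) ∈ [0, ∞]`. -/
def cost (sys : System n m) (ν : Measure (State n)) (K : Policy n m) : ENNReal :=
  ∫⁻ x₀, sampleCost sys K x₀ ∂ν

/-- The domain of the population cost: the policies of finite cost. -/
def finiteCost (sys : System n m) (ν : Measure (State n)) : Set (Policy n m) :=
  {K | cost sys ν K ≠ ⊤}

/-- The population cost as a real number (meaningful on `finiteCost sys ν`). -/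
def J (sys : System n m) (ν : Measure (State n)) (K : Policy n m) : ℝ :=
  (cost sys ν K).toReal

/-- `ν` has mean zero, identity covariance, and is supported in `‖v‖² ≤ Cn`. -/
structure IsStandardized (ν : Measure (State n)) (Cn : ℝ) : Prop where
  isProbabilityMeasure : IsProbabilityMeasure ν
  mean : ∀ i, ∫ v, v i ∂ν = 0
  covariance : ∀ i j, ∫ v, v i * v j ∂ν = if i = j then 1 else 0
  bounded : ∀ᵐ v ∂ν, ‖v‖ ^ 2 ≤ Cn

/-- `Kstar` is a global minimum of the population cost. -/
def IsOptimal (sys : System n m) (ν : Measure (State n)) (Kstar : Policy n m) : Prop :=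
  ∀ K, cost sys ν Kstar ≤ cost sys ν K

/-- The cost is finite on the ball of radius `β` around `K`, and there
`‖∇C(K') - ∇C(K)‖ ≤ φ ‖K' - K‖`. -/
def IsLocallySmoothAt (sys : System n m) (ν : Measure (State n)) (φ β : ℝ)
    (K : Policy n m) : Prop :=
  ∀ K' : Policy n m, ‖K' - K‖ ≤ β → K' ∈ finiteCost sys ν ∧
    ‖gradient (J sys ν) K' - gradient (J sys ν) K‖ ≤ φ * ‖K' - K‖

/-- The cost is finite on the ball of radius `ζ` around `K`, and there
`|C(K') - C(K)| ≤ L ‖K' - K‖`. -/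
def IsLocallyLipschitzAt (sys : System n m) (ν : Measure (State n)) (L ζ : ℝ)
    (K : Policy n m) : Prop :=
  ∀ K' : Policy n m, ‖K' - K‖ ≤ ζ → K' ∈ finiteCost sys ν ∧
    |J sys ν K' - J sys ν K| ≤ L * ‖K' - K‖

/-- The Polyak-Lojasiewicz inequality with constant `μ` on the domain of the cost. -/
def IsPL (sys : System n m) (ν : Measure (State n)) (Kstar : Policy n m) (μ : ℝ) : Prop :=
  ∀ K ∈ finiteCost sys ν,
    μ * (J sys ν K - J sys ν Kstar) ≤ ‖gradient (J sys ν) K‖ ^ 2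

/-- The initial gap `Δ₀ = C(K₀) - C(Kstar)`. -/
def initGap (sys : System n m) (ν : Measure (State n)) (K₀ Kstar : Policy n m) : ℝ :=
  J sys ν K₀ - J sys ν Kstar

/-- The set of policies whose gap is at most ten times the initial gap. -/
def boundedSet (sys : System n m) (ν : Measure (State n)) (K₀ Kstar : Policy n m) :
    Set (Policy n m) :=
  {K | K ∈ finiteCost sys ν ∧ J sys ν K - J sys ν Kstar ≤ 10 * initGap sys ν K₀ Kstar}

/-- Local curvature parameters: at every policy `K` of finite cost, the cost is
`(φ_K, β_K)` locally smooth and `(L_K, ζ_K)` locally Lipschitz, with positive parameters. -/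
def IsLocalCurvature (sys : System n m) (ν : Measure (State n))
    (φ β L ζ : Policy n m → ℝ) : Prop :=
  ∀ K ∈ finiteCost sys ν, 0 < φ K ∧ 0 < β K ∧ 0 < L K ∧ 0 < ζ K ∧
    IsLocallySmoothAt sys ν (φ K) (β K) K ∧ IsLocallyLipschitzAt sys ν (L K) (ζ K) K

/-- `μ > 0` is a PL constant, and `φ = sup φ_K < ∞`, `L = sup L_K < ∞`,
`ρ = inf (min β_K ζ_K) > 0` over the bounded set, for some choice of the local curvature
parameters. -/
def IsCurvature (sys : System n m) (ν : Measure (State n)) (K₀ Kstar : Policy n m)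
    (φ L ρ μ : ℝ) : Prop :=
  0 < μ ∧ IsPL sys ν Kstar μ ∧ 0 < ρ ∧
  ∃ φK βK LK ζK : Policy n m → ℝ, IsLocalCurvature sys ν φK βK LK ζK ∧
    IsLUB (φK '' boundedSet sys ν K₀ Kstar) φ ∧
    IsLUB (LK '' boundedSet sys ν K₀ Kstar) L ∧
    IsGLB ((fun K => min (βK K) (ζK K)) '' boundedSet sys ν K₀ Kstar) ρ

/-- The functional `θ = min {1 / (2 φ), ρ / L}` of the curvature parameters. -/
def curvatureFunctional (φ L ρ : ℝ) : ℝ := min (1 / (2 * φ)) (ρ / L)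

/-- The step-size condition with constant `C`; `c₀` is the cost of the initial policy and
`D` the dimension of the policy space. -/
def StepSizeCondition (C D Cn c₀ φ ρ μ ε r η : ℝ) : Prop :=
  η ≤ C * min (ε * μ * r ^ 2 / (φ * Cn ^ 2 * D ^ 2 * c₀ ^ 2))
    (min (1 / φ) (ρ * r / (Cn * D * c₀)))

/-- The condition on the smoothing radius. -/
def RadiusCondition (c₀ φ L ρ μ ε r : ℝ) : Prop :=
  r ≤ min (curvatureFunctional φ L ρ * μ / (8 * φ) * √(ε / 15))
    (min (1 / (2 * φ) * √(ε * μ / 30)) (min ρ (10 * c₀ / L)))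

/-- The number of iterations `(4 / (η μ)) log (120 Δ₀ / ε)`, rounded up. Each iteration uses
exactly one rollout. -/
def numSteps (Δ₀ μ ε η : ℝ) : ℕ :=
  ⌈4 / (η * μ) * Real.log (120 * Δ₀ / ε)⌉₊

/-- The uniform distribution on the unit sphere of the policy space. -/
def unifSphere (n m : ℕ) : Measure (Policy n m) :=
  (((volume : Measure (Policy n m)).toSphere Set.univ)⁻¹ •
    (volume : Measure (Policy n m)).toSphere).map Subtype.val

/-- The one-point gradient estimate `C(K + r u; x₀) (D / r) u`. -/
def onePointEstimate (sys : System n m) (r : ℝ) (K u : Policy n m) (x₀ : State n) :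
    Policy n m :=
  ((sampleCost sys (K + r • u) x₀).toReal * (((n * m : ℕ) : ℝ) / r)) • u

/-- The iterates `K_{t+1} = K_t - η g(K_t)` of the one-point stochastic zero-order method, driven
by the samples `(x t, u t)`, where `x t` is an initial state and `u t` a direction. -/
def iterate (sys : System n m) (η r : ℝ) (K₀ : Policy n m) (x : ℕ → State n)
    (u : ℕ → Policy n m) : ℕ → Policy n m
  | 0 => K₀
  | t + 1 => iterate sys η r K₀ x u t -
      η • onePointEstimate sys r (iterate sys η r K₀ x u t) (u t) (x t)

/-- The run of length `T` is successful: each of the `T` observed costs is finite (so that the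
algorithm is well defined), and the last iterate has finite cost and gap at most `ε`. -/
def IsSuccessfulRun (sys : System n m) (ν : Measure (State n)) (Kstar : Policy n m)
    (ε η r : ℝ) (K₀ : Policy n m) (T : ℕ) (x : ℕ → State n) (u : ℕ → Policy n m) : Prop :=
  (∀ t < T, sampleCost sys (iterate sys η r K₀ x u t + r • u t) (x t) ≠ ⊤) ∧
  iterate sys η r K₀ x u T ∈ finiteCost sys ν ∧
  J sys ν (iterate sys η r K₀ x u T) - J sys ν Kstar ≤ ε

/-- On the probability space `(Ω, P)`, the pairs `(x t, u t)` are i.i.d., with `x t ∼ ν` and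
`u t` uniform on the unit sphere and independent of `x t`. -/
structure IsSampling {Ω : Type*} [MeasurableSpace Ω] (P : Measure Ω) (ν : Measure (State n))
    (x : ℕ → Ω → State n) (u : ℕ → Ω → Policy n m) : Prop where
  measurable_state : ∀ t, Measurable (x t)
  measurable_direction : ∀ t, Measurable (u t)
  law : ∀ t, P.map (fun ω => (x t ω, u t ω)) = ν.prod (unifSphere n m)
  indep : iIndepFun (fun t ω => (x t ω, u t ω)) P

end LQR

end

/-! For an initial state with identity covariance, the expected discounted cost of stage `t` is the
trace of the `t`-th power of the Lyapunov operator `Z ↦ γ (A - BK)ᵀ Z (A - BK)` applied to `Q +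
KᵀRK`. The cost is finite exactly when the norms of these powers are summable
(`summable_norm_lyap_pow_iff`), and it is then the trace of a resolvent. Hence the domain is open,
the cost is `C²` there, its sublevel sets are compact, and a minimizer and uniform curvature bounds
exist. Gradient dominance (`exists_isPL`) follows from the performance difference formula
`hasSum_J_sub_J`: completing a square bounds the gap by a multiple of the squared norm of a matrix
`E_K`, and moving along `E_K` shows that the gradient has norm at least `2 ‖E_K‖`.

For the algorithm, the bias of the one-point estimate is controlled by symmetry
(`le_integral_J_mul_inner`): each direction `u` is paired with its mirror image in the hyperplane
orthogonal to the gradient, so that the two perturbed costs differ by a finite difference along the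
gradient, up to the smoothness error. With the almost sure bound of a rollout by `Cn` times the cost
and the descent inequality this yields `contraction`: at a policy of the bounded set, one update
multiplies the expected gap by `1 - ημ/2`, up to an additive `ημε/120`.

This drift is available only in the bounded set, so the iterates are stopped on leaving it. Two
functions of the stopped process are followed. The gap with value `10 Δ₀` outside grows at most
linearly in expectation and bounds the probability of leaving; the gap with value `0` outside
contracts and bounds the probability of being inside with gap above `ε`. Markov's inequality makes
these at most `3/20` and `1/40`, together below `1/4`. -/

noncomputable section

namespace LQR

variable {n m : ℕ}

/-! ### Invariance and second moments of the uniform distribution on the sphere -/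

section Sphere

open scoped Pointwise

lemma nonempty_index (hn : 0 < n) (hm : 0 < m) : Nonempty (Fin m × Fin n) :=
  ⟨(⟨0, hm⟩, ⟨0, hn⟩)⟩

lemma unifSphere_apply {s : Set (Policy n m)} (hs : MeasurableSet s) :
    unifSphere n m s = ((volume : Measure (Policy n m)).toSphere Set.univ)⁻¹ *
      (Module.finrank ℝ (Policy n m) *
        volume (Set.Ioo (0 : ℝ) 1 • (s ∩ Metric.sphere (0 : Policy n m) 1))) := by
  rw [unifSphere, Measure.map_apply measurable_subtype_coe hs, Measure.smul_apply, smul_eq_mul,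
    Measure.toSphere_apply' _ (measurable_subtype_coe hs), Subtype.image_preimage_coe,
    Set.inter_comm]

lemma isProbabilityMeasure_unifSphere (hn : 0 < n) (hm : 0 < m) :
    IsProbabilityMeasure (unifSphere n m) := by
  have := nonempty_index hn hm
  refine ⟨?_⟩
  rw [unifSphere, Measure.map_apply measurable_subtype_coe MeasurableSet.univ, Set.preimage_univ,
    Measure.smul_apply, smul_eq_mul]
  refine ENNReal.inv_mul_cancel ?_ (measure_ne_top _ _)
  rw [Ne, Measure.measure_univ_eq_zero, Measure.toSphere_eq_zero_iff]
  exact not_subsingleton _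

lemma ae_norm_unifSphere : ∀ᵐ u ∂(unifSphere n m), ‖u‖ = 1 := by
  rw [unifSphere, ae_map_iff measurable_subtype_coe.aemeasurable
    (measurableSet_eq_fun measurable_norm measurable_const)]
  filter_upwards with u
  simp

/-- The measure of a subset of the sphere is proportional to the Lebesgue measure of the cone over
it, and a linear isometry maps cones to cones and preserves Lebesgue measure. -/
lemma unifSphere_map_isometry (f : Policy n m ≃ₗᵢ[ℝ] Policy n m) :
    (unifSphere n m).map f = unifSphere n m := by
  ext s hs
  have hf : Measurable f := f.continuous.measurable
  rw [Measure.map_apply hf hs, unifSphere_apply (hf hs), unifSphere_apply hs]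
  congr 2
  refine Eq.trans ?_ (f.measurePreserving.measure_preimage_equiv (f := f.toMeasurableEquiv) _)
  congr 1
  ext v
  simp only [Set.mem_smul, Set.mem_preimage, Set.mem_inter_iff, mem_sphere_zero_iff_norm]
  constructor
  · rintro ⟨a, ha, w, ⟨hw, hw1⟩, rfl⟩
    exact ⟨a, ha, f w, ⟨hw, by simpa using hw1⟩, by simp⟩
  · rintro ⟨a, ha, w, ⟨hw, hw1⟩, h⟩
    refine ⟨a, ha, f.symm w, ⟨by simpa using hw, by simpa using hw1⟩, ?_⟩
    apply f.injective
    simpa using h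

lemma integral_unifSphere_isometry (f : Policy n m ≃ₗᵢ[ℝ] Policy n m) (g : Policy n m → ℝ) :
    ∫ u, g (f u) ∂(unifSphere n m) = ∫ u, g u ∂(unifSphere n m) := by
  conv_rhs => rw [← unifSphere_map_isometry f]
  exact (integral_map_equiv f.toMeasurableEquiv g).symm

/-- The reflection in the hyperplane bisecting `v` and `w` exchanges the two. -/
lemma exists_isometry_inner_eq {E : Type*} [NormedAddCommGroup E] [InnerProductSpace ℝ E]
    [CompleteSpace E] {v w : E} (h : ‖v‖ = ‖w‖) :
    ∃ f : E ≃ₗᵢ[ℝ] E, ∀ u, inner ℝ (f u) v = inner ℝ u w := by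
  refine ⟨(ℝ ∙ (v - w))ᗮ.reflection, fun u => ?_⟩
  have hw : (ℝ ∙ (v - w))ᗮ.reflection w = v := by
    conv_lhs => rw [← congrArg (ℝ ∙ (v - w))ᗮ.reflection (Submodule.reflection_sub h)]
    exact Submodule.reflection_reflection _ _
  rw [← LinearIsometryEquiv.inner_map_map (ℝ ∙ (v - w))ᗮ.reflection u w, hw]

/-- Supplies the mirror image of a direction: `u` and `f u` differ only along `w`, which turns a
difference of two costs into a finite difference along `w`. -/
lemma exists_isometry_reflection {E : Type*} [NormedAddCommGroup E] [InnerProductSpace ℝ E]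
    [CompleteSpace E] (w : E) :
    ∃ f : E ≃ₗᵢ[ℝ] E, (∀ u, inner ℝ (f u) w = - inner ℝ u w) ∧
      ∀ u, u - f u = (2 * inner ℝ u w / ‖w‖ ^ 2) • w := by
  have h2 : ∀ u, (ℝ ∙ w)ᗮ.reflection u = u - (2 * inner ℝ u w / ‖w‖ ^ 2) • w := by
    intro u
    rw [Submodule.reflection_orthogonal_apply, Submodule.reflection_singleton_apply]
    rw [two_nsmul]
    rw [real_inner_comm]
    module
  refine ⟨(ℝ ∙ w)ᗮ.reflection, fun u => ?_, fun u => ?_⟩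
  · rw [h2]
    rcases eq_or_ne w 0 with rfl | hw
    · simp
    · have : ‖w‖ ^ 2 ≠ 0 := by positivity
      rw [inner_sub_left, inner_smul_left, real_inner_self_eq_norm_sq]
      simp only [conj_trivial]
      field_simp
      ring
  · rw [h2]
    module

lemma integrable_sq_inner_unifSphere (hn : 0 < n) (hm : 0 < m) (w : Policy n m) :
    Integrable (fun u => (inner ℝ u w) ^ 2) (unifSphere n m) := by
  have := isProbabilityMeasure_unifSphere hn hm
  refine Integrable.of_bound (C := ‖w‖ ^ 2) (by fun_prop) ?_
  filter_upwards [ae_norm_unifSphere] with u hu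
  rw [Real.norm_eq_abs, abs_pow]
  gcongr
  simpa [hu] using abs_real_inner_le_norm u w

/-- By rotation invariance the integral depends on `‖w‖` only. Summed over the basis vectors scaled
to length `‖w‖`, the integrand is the constant `‖w‖ ^ 2`. -/
lemma integral_sq_inner_unifSphere (hn : 0 < n) (hm : 0 < m) (w : Policy n m) :
    ((n * m : ℕ) : ℝ) * ∫ u, (inner ℝ u w) ^ 2 ∂(unifSphere n m) = ‖w‖ ^ 2 := by
  have := isProbabilityMeasure_unifSphere hn hm
  have hrot : ∀ v w : Policy n m, ‖v‖ = ‖w‖ →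
      ∫ u, (inner ℝ u v) ^ 2 ∂(unifSphere n m) = ∫ u, (inner ℝ u w) ^ 2 ∂(unifSphere n m) := by
    intro v w h
    obtain ⟨f, hf⟩ := exists_isometry_inner_eq h
    rw [← integral_unifSphere_isometry f]
    simp only [hf]
  have hbasis : ∀ i, ∫ u, (inner ℝ u (EuclideanSpace.single i (‖w‖))) ^ 2 ∂(unifSphere n m)
      = ∫ u, (inner ℝ u w) ^ 2 ∂(unifSphere n m) := fun i => hrot _ _ (by simp)
  have hsum : ∑ i : Fin m × Fin n,
      ∫ u, (inner ℝ u (EuclideanSpace.single i (‖w‖))) ^ 2 ∂(unifSphere n m) = ‖w‖ ^ 2 := by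
    rw [← integral_finsetSum _ fun i _ => integrable_sq_inner_unifSphere hn hm _]
    have : ∀ᵐ u ∂(unifSphere n m),
        ∑ i, (inner ℝ u (EuclideanSpace.single i (‖w‖))) ^ 2 = ‖w‖ ^ 2 := by
      filter_upwards [ae_norm_unifSphere] with u hu
      have h1 : ∑ i, u i ^ 2 = 1 := by
        rw [← EuclideanSpace.real_norm_sq_eq, hu, one_pow]
      simp [EuclideanSpace.inner_single_right, mul_pow, ← Finset.mul_sum, h1]
    rw [integral_congr_ae this]
    simp
  rw [← hsum, Finset.sum_congr rfl fun i _ => hbasis i]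
  simp [mul_comm]

end Sphere

/-! ### Frobenius norms and quadratic forms -/

open scoped Matrix

/-- The squared Frobenius norm of a matrix. -/
def frobSq {ι κ : Type*} [Fintype ι] [Fintype κ] (Z : Matrix ι κ ℝ) : ℝ := ∑ i, ∑ j, Z i j ^ 2

section frobSq
variable {ι κ l : Type*} [Fintype ι] [Fintype κ] [Fintype l]

lemma frobSq_nonneg (Z : Matrix ι κ ℝ) : 0 ≤ frobSq Z := by
  unfold frobSq; positivity

lemma frobSq_transpose (Z : Matrix ι κ ℝ) : frobSq Zᵀ = frobSq Z := by
  unfold frobSq; rw [Finset.sum_comm]; rfl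

lemma frobSq_mul_le (Y : Matrix ι κ ℝ) (Z : Matrix κ l ℝ) :
    frobSq (Y * Z) ≤ frobSq Y * frobSq Z := by
  have h : frobSq Y * frobSq Z = ∑ i, ∑ j, (∑ k, Y i k ^ 2) * ∑ k, Z k j ^ 2 := by
    unfold frobSq
    rw [Finset.sum_comm (f := fun i j => Z i j ^ 2), Finset.sum_mul_sum]
  rw [h]
  unfold frobSq
  gcongr with i _ j _
  rw [Matrix.mul_apply]
  exact Finset.sum_mul_sq_le_sq_mul_sq _ _ _

lemma frobSq_eq_sum_col (Z : Matrix ι κ ℝ) :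
    frobSq Z = ∑ j, (fun i => Z i j) ⬝ᵥ (fun i => Z i j) := by
  unfold frobSq
  rw [Finset.sum_comm]
  simp [dotProduct, sq]

lemma dotProduct_mulVec_self_le (Z : Matrix ι κ ℝ) (y : κ → ℝ) :
    (Z *ᵥ y) ⬝ᵥ (Z *ᵥ y) ≤ frobSq Z * (y ⬝ᵥ y) := by
  unfold frobSq
  simp only [dotProduct, Matrix.mulVec]
  rw [Finset.sum_mul]
  refine Finset.sum_le_sum fun i _ => ?_
  rw [← sq]
  refine (Finset.sum_mul_sq_le_sq_mul_sq _ _ _).trans_eq ?_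
  simp [sq]

/-- The trace of `Yᵀ Z Y` is the sum of the values of the form `Z` at the columns of `Y`. -/
lemma trace_transpose_mul_mul (Z : Matrix ι ι ℝ) (Y : Matrix ι κ ℝ) :
    (Yᵀ * Z * Y).trace = ∑ j, (fun i => Y i j) ⬝ᵥ Z *ᵥ (fun i => Y i j) := by
  simp only [Matrix.trace, Matrix.diag, Matrix.mul_assoc]
  refine Finset.sum_congr rfl fun j _ => ?_
  simp [Matrix.mul_apply, dotProduct, Matrix.mulVec]

lemma dotProduct_transpose_mul_mul (Z : Matrix ι ι ℝ) (Y : Matrix ι κ ℝ) (x : κ → ℝ) :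
    x ⬝ᵥ (Yᵀ * Z * Y) *ᵥ x = (Y *ᵥ x) ⬝ᵥ Z *ᵥ (Y *ᵥ x) := by
  rw [← Matrix.mulVec_mulVec, ← Matrix.mulVec_mulVec, Matrix.dotProduct_mulVec,
    Matrix.vecMul_transpose]

/-- The constant is the minimum of the form on the compact unit sphere; homogeneity extends the
bound. -/
lemma posDef_lower_bound {Z : Matrix ι ι ℝ} (hZ : Z.PosDef) :
    ∃ q, 0 < q ∧ ∀ x : ι → ℝ, q * (x ⬝ᵥ x) ≤ x ⬝ᵥ Z *ᵥ x := by
  have hpos : ∀ x : ι → ℝ, x ≠ 0 → 0 < x ⬝ᵥ Z *ᵥ x := fun x hx => by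
    simpa using hZ.dotProduct_mulVec_pos hx
  have hnorm : ∀ x : EuclideanSpace ℝ ι, x.ofLp ⬝ᵥ x.ofLp = ‖x‖ ^ 2 := fun x => by
    rw [EuclideanSpace.real_norm_sq_eq]; simp [dotProduct, sq]
  rcases isEmpty_or_nonempty ι with h | h
  · exact ⟨1, one_pos, fun x => by simp [dotProduct]⟩
  have hcont : Continuous fun x : EuclideanSpace ℝ ι => x.ofLp ⬝ᵥ Z *ᵥ x.ofLp := by
    simp only [dotProduct, Matrix.mulVec]; fun_prop
  obtain ⟨x₀, hx₀, hmin⟩ := (isCompact_sphere (0 : EuclideanSpace ℝ ι) 1).exists_isMinOn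
    (NormedSpace.sphere_nonempty.2 zero_le_one) hcont.continuousOn
  have hx₀' : ‖x₀‖ = 1 := by simpa using hx₀
  refine ⟨_, hpos x₀.ofLp fun h0 => ?_, fun x => ?_⟩
  · have : x₀ = 0 := by ext i; simp [h0]
    simp [this] at hx₀'
  · rcases eq_or_ne x 0 with rfl | hx
    · simp
    set y : EuclideanSpace ℝ ι := WithLp.toLp 2 x with hy
    have hy0 : y ≠ 0 := fun h0 => hx (by simpa [hy] using h0)
    have hyn : 0 < ‖y‖ := norm_pos_iff.2 hy0
    have := hmin (show ‖y‖⁻¹ • y ∈ Metric.sphere (0 : EuclideanSpace ℝ ι) 1 by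
      simp [norm_smul, hyn.ne'])
    simp only [Set.mem_ofPred_eq, WithLp.ofLp_smul, Matrix.mulVec_smul, smul_dotProduct,
      dotProduct_smul, smul_eq_mul] at this
    have hxx : x ⬝ᵥ x = ‖y‖ ^ 2 := hnorm y
    rw [hxx]
    calc _ ≤ ‖y‖⁻¹ * (‖y‖⁻¹ * (y.ofLp ⬝ᵥ Z *ᵥ y.ofLp)) * ‖y‖ ^ 2 := by gcongr
      _ = _ := by field_simp; rfl

/-- A nonnegative form is dominated by its trace. -/
lemma quadForm_le_trace [DecidableEq ι] {Z : Matrix ι ι ℝ} (hZ : Z.PosSemidef) (x : ι → ℝ) :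
    x ⬝ᵥ Z *ᵥ x ≤ Z.trace * (x ⬝ᵥ x) := by
  -- With `Z = Wᵀ W` the trace is the squared Frobenius norm of `W`, and the claim becomes
  -- Cauchy-Schwarz.
  obtain ⟨W, rfl⟩ : ∃ W : Matrix ι ι ℝ, Z = Wᵀ * W := by
    open scoped MatrixOrder in
    obtain ⟨W, hW⟩ := CStarAlgebra.nonneg_iff_eq_star_mul_self.1 hZ.nonneg
    exact ⟨W, by simpa [Matrix.star_eq_conjTranspose] using hW⟩
  have h1 := dotProduct_transpose_mul_mul (1 : Matrix ι ι ℝ) W x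
  have h2 := trace_transpose_mul_mul (1 : Matrix ι ι ℝ) W
  rw [Matrix.mul_one] at h1 h2
  simp only [Matrix.one_mulVec] at h1 h2
  rw [h1, h2, ← frobSq_eq_sum_col]
  exact dotProduct_mulVec_self_le W x

end frobSq

/-! ### The cost as a series in the Lyapunov operator -/

/-- The policy with a given matrix. -/
def Policy.ofMat (Z : Matrix (Fin m) (Fin n) ℝ) : Policy n m :=
  WithLp.toLp 2 fun p => Z p.1 p.2

@[simp] lemma Policy.mat_ofMat (Z : Matrix (Fin m) (Fin n) ℝ) : (Policy.ofMat Z).mat = Z := rfl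

@[simp] lemma Policy.mat_add (K K' : Policy n m) : (K + K').mat = K.mat + K'.mat := rfl

@[simp] lemma Policy.mat_smul (c : ℝ) (K : Policy n m) : (c • K).mat = c • K.mat := rfl

@[simp] lemma Policy.mat_sub (K K' : Policy n m) : (K - K').mat = K.mat - K'.mat := rfl

lemma Policy.norm_sq (K : Policy n m) : ‖K‖ ^ 2 = frobSq K.mat := by
  rw [EuclideanSpace.real_norm_sq_eq, Fintype.sum_prod_type]
  rfl

/-- The closed-loop matrix `A - B K`. -/
def closedLoop (sys : System n m) (K : Policy n m) : Matrix (Fin n) (Fin n) ℝ :=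
  sys.A - sys.B * K.mat

/-- The matrix `Q + Kᵀ R K` of the stage cost under the policy `K`. -/
def costMatrix (sys : System n m) (K : Policy n m) : Matrix (Fin n) (Fin n) ℝ :=
  sys.Q + K.matᵀ * sys.R * K.mat

/-- The operator `Z ↦ γ (A - B K)ᵀ Z (A - B K)`, on the Frobenius space of `n × n` matrices. -/
def lyap (sys : System n m) (K : Policy n m) : Policy n n →L[ℝ] Policy n n :=
  LinearMap.toContinuousLinearMap
    { toFun := fun Z => Policy.ofMat (sys.γ • ((closedLoop sys K)ᵀ * Z.mat * closedLoop sys K))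
      map_add' := fun Y Z => by
        ext p
        simp [Policy.ofMat, Matrix.add_mul, mul_add]
      map_smul' := fun c Z => by
        ext p
        simp [Policy.ofMat]
        ring }

lemma mat_lyap (sys : System n m) (K : Policy n m) (Z : Policy n n) :
    (lyap sys K Z).mat = sys.γ • ((closedLoop sys K)ᵀ * Z.mat * closedLoop sys K) := rfl

lemma mat_lyap_pow (sys : System n m) (K : Policy n m) (t : ℕ) (Z : Policy n n) :
    ((lyap sys K ^ t) Z).mat =
      sys.γ ^ t • ((closedLoop sys K ^ t)ᵀ * Z.mat * closedLoop sys K ^ t) := by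
  induction t with
  | zero => simp
  | succ t ih =>
    rw [pow_succ', mul_apply_eq_comp, mat_lyap, ih, pow_succ (closedLoop sys K),
      Matrix.transpose_mul]
    simp only [Matrix.mul_smul, Matrix.smul_mul, smul_smul, Matrix.mul_assoc, pow_succ' sys.γ]

lemma traj_eq (sys : System n m) (K : Policy n m) (x : State n) (t : ℕ) :
    traj sys K x t = (closedLoop sys K ^ t) *ᵥ x.ofLp := by
  induction t with
  | zero => simp [traj]
  | succ t ih =>
    rw [traj, ih, pow_succ', ← Matrix.mulVec_mulVec, control, Matrix.mulVec_neg,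
      Matrix.mulVec_mulVec _ sys.B]
    conv_rhs => rw [closedLoop, Matrix.sub_mulVec]
    rw [sub_eq_add_neg]; rfl

lemma stageCost_control (sys : System n m) (K : Policy n m) (x : Fin n → ℝ) :
    stageCost sys x (control K x) = x ⬝ᵥ costMatrix sys K *ᵥ x := by
  rw [stageCost, costMatrix, Matrix.add_mulVec, dotProduct_add, dotProduct_transpose_mul_mul,
    control, Matrix.mulVec_neg, neg_dotProduct_neg]

/-- Replaces trajectories by powers of one linear operator, which depends polynomially on the
policy. -/
lemma discounted_stageCost (sys : System n m) (K : Policy n m) (x : State n) (t : ℕ) :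
    sys.γ ^ t * stageCost sys (traj sys K x t) (control K (traj sys K x t)) =
      x.ofLp ⬝ᵥ ((lyap sys K ^ t) (Policy.ofMat (costMatrix sys K))).mat *ᵥ x.ofLp := by
  rw [stageCost_control, mat_lyap_pow, Matrix.smul_mulVec, dotProduct_smul, smul_eq_mul,
    Policy.mat_ofMat, dotProduct_transpose_mul_mul, traj_eq]

lemma posDef_costMatrix (sys : System n m) (K : Policy n m) : (costMatrix sys K).PosDef := by
  refine sys.posDef_Q.add_posSemidef ?_
  simpa using sys.posDef_R.posSemidef.conjTranspose_mul_mul_same K.mat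

lemma posSemidef_lyap_pow (sys : System n m) (K : Policy n m) (t : ℕ) {Z : Policy n n}
    (hZ : Z.mat.PosSemidef) : ((lyap sys K ^ t) Z).mat.PosSemidef := by
  rw [mat_lyap_pow]
  refine Matrix.PosSemidef.smul ?_ (pow_nonneg sys.γ_pos.le t)
  simpa using hZ.conjTranspose_mul_mul_same (closedLoop sys K ^ t)

/-- The expected cost of stage `t` under an initial distribution of identity covariance. -/
def costTerm (sys : System n m) (K : Policy n m) (t : ℕ) : ℝ :=
  ((lyap sys K ^ t) (Policy.ofMat (costMatrix sys K))).mat.trace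

lemma costTerm_nonneg (sys : System n m) (K : Policy n m) (t : ℕ) : 0 ≤ costTerm sys K t :=
  (posSemidef_lyap_pow sys K t (Z := Policy.ofMat (costMatrix sys K))
    (posDef_costMatrix sys K).posSemidef).trace_nonneg

lemma norm_lyap_pow_le (sys : System n m) (K : Policy n m) (t : ℕ) :
    ‖lyap sys K ^ t‖ ≤ sys.γ ^ t * frobSq (closedLoop sys K ^ t) := by
  have h0 := frobSq_nonneg (closedLoop sys K ^ t)
  have hγ := pow_nonneg sys.γ_pos.le t
  refine ContinuousLinearMap.opNorm_le_bound _ (by positivity) fun Z => ?_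
  refine le_of_sq_le_sq ?_ (by positivity)
  rw [mul_pow, Policy.norm_sq, Policy.norm_sq, mat_lyap_pow]
  have h1 : ∀ (c : ℝ) (Y : Matrix (Fin n) (Fin n) ℝ), frobSq (c • Y) = c ^ 2 * frobSq Y := by
    intro c Y; simp [frobSq, mul_pow, Finset.mul_sum]
  have h2 : frobSq ((closedLoop sys K ^ t)ᵀ * Z.mat * closedLoop sys K ^ t) ≤
      frobSq (closedLoop sys K ^ t) * frobSq Z.mat * frobSq (closedLoop sys K ^ t) := by
    refine (frobSq_mul_le _ _).trans (mul_le_mul_of_nonneg_right ?_ h0)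
    exact (frobSq_mul_le _ _).trans_eq (by rw [frobSq_transpose])
  rw [h1]
  calc _ ≤ (sys.γ ^ t) ^ 2 * (frobSq (closedLoop sys K ^ t) * frobSq Z.mat *
        frobSq (closedLoop sys K ^ t)) := by gcongr
    _ = _ := by ring

/-- Monotonicity of the trace of the iterated Lyapunov operator in the quadratic form. -/
lemma mul_frobSq_le_trace_lyap_pow (sys : System n m) (K : Policy n m) (t : ℕ) (Z : Policy n n)
    (q : ℝ) (hq : ∀ x : Fin n → ℝ, q * (x ⬝ᵥ x) ≤ x ⬝ᵥ Z.mat *ᵥ x) :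
    q * (sys.γ ^ t * frobSq (closedLoop sys K ^ t)) ≤ ((lyap sys K ^ t) Z).mat.trace := by
  have hγ := pow_nonneg sys.γ_pos.le t
  rw [mat_lyap_pow, Matrix.trace_smul, trace_transpose_mul_mul, frobSq_eq_sum_col, smul_eq_mul]
  calc _ = sys.γ ^ t * ∑ j, q * ((fun i => (closedLoop sys K ^ t) i j) ⬝ᵥ
        (fun i => (closedLoop sys K ^ t) i j)) := by rw [← Finset.mul_sum]; ring
    _ ≤ _ := by gcongr; exact hq _

/-! ### Summable powers in a normed ring -/

section Geometric
variable {𝔸 : Type*} [NormedRing 𝔸]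

/-- Writing `t = k q + i` with `i < k` bounds the terms by a geometric series in `q` times finitely
many constants. -/
lemma summable_norm_pow_of_norm_pow_lt_one {a : 𝔸} {k : ℕ} (hk : 0 < k) (h : ‖a ^ k‖ < 1) :
    Summable fun t : ℕ => ‖a ^ t‖ := by
  have : NeZero k := ⟨hk.ne'⟩
  rw [← (Nat.divModEquiv k).symm.summable_iff]
  -- The factor `‖1‖ + 1` covers `q = 0`, where `‖a ^ 0‖ = ‖1‖` need not be at most `1`.
  have hg : Summable fun i : Fin k => (‖(1 : 𝔸)‖ + 1) * ‖a ^ (i : ℕ)‖ := Summable.of_finite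
  have h1 : Summable fun p : ℕ × Fin k => ‖a ^ k‖ ^ p.1 * ((‖(1 : 𝔸)‖ + 1) * ‖a ^ (p.2 : ℕ)‖) :=
    (summable_geometric_of_lt_one (norm_nonneg _) h).mul_of_nonneg hg
      (fun _ => pow_nonneg (norm_nonneg _) _)
      (fun _ => mul_nonneg (add_nonneg (norm_nonneg _) zero_le_one) (norm_nonneg _))
  refine Summable.of_nonneg_of_le (fun _ => norm_nonneg _) (fun p => ?_) h1
  have hp : (Nat.divModEquiv k).symm p = k * p.1 + p.2 := by
    simp [Nat.divModEquiv, mul_comm]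
  simp only [Function.comp_apply]
  rw [hp, pow_add, pow_mul, ← mul_assoc]
  refine (norm_mul_le _ _).trans ?_
  gcongr
  rcases Nat.eq_zero_or_pos p.1 with h0 | h0
  · rw [h0]; simp
  · calc _ ≤ ‖a ^ k‖ ^ p.1 := norm_pow_le' _ h0
      _ ≤ _ := le_mul_of_one_le_right (by positivity) (by linarith [norm_nonneg (1 : 𝔸)])

/-- One power of norm below `1` certifies summability, and each single power is continuous in `a`;
this is what makes the domain of the cost open. -/
lemma isOpen_exists_norm_pow_lt_one : IsOpen {a : 𝔸 | ∃ k, 0 < k ∧ ‖a ^ k‖ < 1} := by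
  have : {a : 𝔸 | ∃ k, 0 < k ∧ ‖a ^ k‖ < 1} = ⋃ k, ⋃ (_ : 0 < k), {a | ‖a ^ k‖ < 1} := by
    ext; simp
  rw [this]
  refine isOpen_iUnion fun k => isOpen_iUnion fun _ => ?_
  exact isOpen_lt (by fun_prop) continuous_const

variable [CompleteSpace 𝔸]

lemma isUnit_one_sub_of_summable {a : 𝔸} (h : Summable fun t : ℕ => ‖a ^ t‖) :
    IsUnit (1 - a) := by
  have hs : Summable (a ^ ·) := h.of_norm
  exact ⟨⟨1 - a, ∑' t, a ^ t, hs.one_sub_mul_tsum_pow, hs.tsum_pow_mul_one_sub⟩, rfl⟩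

lemma inverse_one_sub_of_summable {a : 𝔸} (h : Summable fun t : ℕ => ‖a ^ t‖) :
    Ring.inverse (1 - a) = ∑' t, a ^ t := by
  have hs : Summable (a ^ ·) := h.of_norm
  exact Ring.inverse_unit ⟨1 - a, ∑' t, a ^ t, hs.one_sub_mul_tsum_pow, hs.tsum_pow_mul_one_sub⟩

end Geometric

/-- The trace of a matrix as a functional on the Frobenius space. -/
def traceCLM (n : ℕ) : Policy n n →L[ℝ] ℝ :=
  LinearMap.toContinuousLinearMap
    { toFun := fun Z => Z.mat.trace
      map_add' := fun Y Z => by simp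
      map_smul' := fun c Z => by simp }

/-! ### Domain, regularity and minimizers of the cost -/

section Cost
variable {sys : System n m} {ν : Measure (State n)} {Cn : ℝ} {K : Policy n m}

lemma quadForm_eq_sum (Z : Matrix (Fin n) (Fin n) ℝ) (x : Fin n → ℝ) :
    x ⬝ᵥ Z *ᵥ x = ∑ i, ∑ j, Z i j * (x i * x j) := by
  simp only [dotProduct, Matrix.mulVec, Finset.mul_sum]
  exact Finset.sum_congr rfl fun i _ => Finset.sum_congr rfl fun j _ => by ring

lemma IsStandardized.integrable_mul (h : IsStandardized ν Cn) (i j : Fin n) :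
    Integrable (fun v : State n => v i * v j) ν := by
  have := h.isProbabilityMeasure
  refine Integrable.of_bound (C := Cn) (by fun_prop) ?_
  filter_upwards [h.bounded] with v hv
  rw [norm_mul]
  refine le_trans ?_ hv
  rw [sq]
  gcongr
  · exact PiLp.norm_apply_le v i
  · exact PiLp.norm_apply_le v j

lemma IsStandardized.lintegral_quadForm (h : IsStandardized ν Cn) {Z : Matrix (Fin n) (Fin n) ℝ}
    (hZ : Z.PosSemidef) :
    ∫⁻ v, ENNReal.ofReal (v.ofLp ⬝ᵥ Z *ᵥ v.ofLp) ∂ν = ENNReal.ofReal Z.trace := by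
  have hint : ∀ i j, Integrable (fun v : State n => Z i j * (v i * v j)) ν := fun i j =>
    (h.integrable_mul i j).const_mul _
  simp only [quadForm_eq_sum]
  rw [← ofReal_integral_eq_lintegral_ofReal]
  · rw [integral_finsetSum _ fun i _ => integrable_finsetSum _ fun j _ => hint i j]
    simp only [integral_finsetSum _ fun j _ => hint _ j, integral_const_mul, h.covariance]
    simp [Matrix.trace]
  · exact integrable_finsetSum _ fun i _ => integrable_finsetSum _ fun j _ => hint i j
  · refine Filter.Eventually.of_forall fun v => ?_
    simp only [Pi.zero_apply]
    rw [← quadForm_eq_sum]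
    simpa using hZ.dotProduct_mulVec_nonneg v.ofLp

lemma measurable_sampleCost_uncurry (sys : System n m) :
    Measurable fun p : Policy n m × State n => sampleCost sys p.1 p.2 := by
  have htraj : ∀ t, Continuous fun p : Policy n m × State n => traj sys p.1 p.2 t := by
    intro t
    induction t with
    | zero => simp only [traj]; fun_prop
    | succ t ih =>
      simp only [traj, control, Policy.mat]
      have : ∀ i, Continuous fun p : Policy n m × State n => traj sys p.1 p.2 t i :=
        fun i => (continuous_apply i).comp ih
      refine continuous_pi fun i => ?_
      simp only [Pi.add_apply, Matrix.mulVec, dotProduct, Pi.neg_apply, Matrix.of_apply]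
      fun_prop
  unfold sampleCost
  refine Measurable.tsum fun t => ENNReal.measurable_ofReal.comp ?_
  have : ∀ i, Continuous fun p : Policy n m × State n => traj sys p.1 p.2 t i :=
    fun i => (continuous_apply i).comp (htraj t)
  refine Continuous.measurable ?_
  simp only [stageCost, control, Policy.mat, Matrix.mulVec, dotProduct, Pi.neg_apply,
    Matrix.of_apply]
  fun_prop

lemma measurable_cost [SFinite ν] : Measurable (cost sys ν) :=
  (measurable_sampleCost_uncurry sys).lintegral_prod_right'

lemma cost_eq_tsum (h : IsStandardized ν Cn) (K : Policy n m) :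
    cost sys ν K = ∑' t, ENNReal.ofReal (costTerm sys K t) := by
  unfold cost sampleCost
  simp only [discounted_stageCost]
  rw [lintegral_tsum]
  · congr 1
    ext t
    exact h.lintegral_quadForm (posSemidef_lyap_pow sys K t (Z := Policy.ofMat (costMatrix sys K))
      (posDef_costMatrix sys K).posSemidef)
  · intro t
    refine (ENNReal.measurable_ofReal.comp ?_).aemeasurable
    simp only [dotProduct, Matrix.mulVec]
    fun_prop

/-- Each stage is a nonnegative form in `x`, hence at most its trace times `‖x‖ ^ 2`, and the traces
sum to the population cost. This bounds a single observed rollout. -/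
lemma sampleCost_le (h : IsStandardized ν Cn) (K : Policy n m) (x : State n) :
    sampleCost sys K x ≤ ENNReal.ofReal (‖x‖ ^ 2) * cost sys ν K := by
  rw [cost_eq_tsum h, ← ENNReal.tsum_mul_left]
  unfold sampleCost
  simp only [discounted_stageCost]
  refine ENNReal.tsum_le_tsum fun t => ?_
  rw [← ENNReal.ofReal_mul (by positivity)]
  refine ENNReal.ofReal_le_ofReal ?_
  refine (quadForm_le_trace (posSemidef_lyap_pow sys K t (Z := Policy.ofMat (costMatrix sys K))
      (posDef_costMatrix sys K).posSemidef) _).trans_eq ?_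
  rw [mul_comm, EuclideanSpace.real_norm_sq_eq]
  simp [costTerm, dotProduct, sq]

lemma sampleCost_ne_top (h : IsStandardized ν Cn) (hK : K ∈ finiteCost sys ν) (x : State n) :
    sampleCost sys K x ≠ ⊤ :=
  ne_top_of_le_ne_top (ENNReal.mul_ne_top ENNReal.ofReal_ne_top hK) (sampleCost_le h K x)

lemma summable_costTerm_iff (h : IsStandardized ν Cn) :
    K ∈ finiteCost sys ν ↔ Summable (costTerm sys K) := by
  rw [finiteCost, Set.mem_ofPred_eq, cost_eq_tsum h]
  constructor
  · intro hfin
    have := ENNReal.summable_toReal hfin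
    simpa [ENNReal.toReal_ofReal, costTerm_nonneg] using this
  · exact fun hs => hs.tsum_ofReal_ne_top

/-- The stage costs and the operator norms control each other: since `Q + KᵀRK` is positive
definite, a stage cost dominates a multiple of `γᵗ ‖(A - BK)ᵗ‖²`, which dominates the operator norm;
the converse bound is continuity of the trace. -/
lemma summable_norm_lyap_pow_iff (h : IsStandardized ν Cn) :
    K ∈ finiteCost sys ν ↔ Summable fun t => ‖lyap sys K ^ t‖ := by
  rw [summable_costTerm_iff h]
  constructor
  · intro hs
    obtain ⟨q, hq, hq'⟩ := posDef_lower_bound (posDef_costMatrix sys K)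
    refine Summable.of_nonneg_of_le (fun _ => norm_nonneg _) (fun t => ?_) (hs.mul_left q⁻¹)
    refine (norm_lyap_pow_le sys K t).trans ?_
    rw [← div_eq_inv_mul, le_div_iff₀' hq]
    exact mul_frobSq_le_trace_lyap_pow sys K t (Policy.ofMat (costMatrix sys K)) q hq'
  · intro hs
    refine Summable.of_nonneg_of_le (costTerm_nonneg sys K) (fun t => ?_)
      ((hs.mul_right ‖Policy.ofMat (costMatrix sys K)‖).mul_left ‖traceCLM n‖)
    refine (le_abs_self _).trans ?_
    refine ((traceCLM n).le_opNorm _).trans ?_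
    gcongr
    exact ContinuousLinearMap.le_opNorm _ _

lemma mem_finiteCost_iff_exists (h : IsStandardized ν Cn) :
    K ∈ finiteCost sys ν ↔ ∃ k, 0 < k ∧ ‖lyap sys K ^ k‖ < 1 := by
  rw [summable_norm_lyap_pow_iff h]
  constructor
  · intro hs
    have := hs.tendsto_atTop_zero.eventually (gt_mem_nhds one_pos)
    obtain ⟨k, hk0, hk⟩ := (this.and (Filter.eventually_gt_atTop 0)).exists
    exact ⟨k, hk, hk0⟩
  · rintro ⟨k, hk, hk'⟩
    exact summable_norm_pow_of_norm_pow_lt_one hk hk'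

lemma contDiff_lyap (sys : System n m) : ContDiff ℝ 2 (lyap sys) := by
  rw [contDiff_clm_apply_iff]
  intro Z
  rw [contDiff_euclidean]
  intro p
  have : ∀ K, (lyap sys K) Z p =
    sys.γ * ((closedLoop sys K)ᵀ * Z.mat * closedLoop sys K) p.1 p.2 := fun K => rfl
  simp only [this, closedLoop, Matrix.mul_apply, Matrix.transpose_apply, Matrix.sub_apply,
    Policy.mat, Matrix.of_apply]
  fun_prop

lemma contDiff_costMatrix (sys : System n m) :
    ContDiff ℝ 2 fun K => (Policy.ofMat (costMatrix sys K) : Policy n n) := by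
  rw [contDiff_euclidean]
  intro p
  simp only [Policy.ofMat, costMatrix, Matrix.mul_apply, Matrix.transpose_apply, Matrix.add_apply,
    Policy.mat, Matrix.of_apply]
  fun_prop

theorem isOpen_finiteCost (h : IsStandardized ν Cn) : IsOpen (finiteCost sys ν) := by
  have : finiteCost sys ν = lyap sys ⁻¹' {a | ∃ k, 0 < k ∧ ‖a ^ k‖ < 1} := by
    ext K; exact mem_finiteCost_iff_exists h
  rw [this]
  exact isOpen_exists_norm_pow_lt_one.preimage (contDiff_lyap sys).continuous

lemma J_eq_tsum (h : IsStandardized ν Cn) (K : Policy n m) :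
    J sys ν K = ∑' t, costTerm sys K t := by
  rw [J, cost_eq_tsum h, ENNReal.tsum_toReal_eq fun _ => ENNReal.ofReal_ne_top]
  simp [ENNReal.toReal_ofReal, costTerm_nonneg]

/-- The value matrix `P = ∑ₜ γᵗ ((A - B K)ᵗ)ᵀ (Q + Kᵀ R K) (A - B K)ᵗ`. -/
def valueMat (sys : System n m) (K : Policy n m) : Policy n n :=
  Ring.inverse (1 - lyap sys K) (Policy.ofMat (costMatrix sys K))

lemma hasSum_lyap_pow_apply (hs : Summable fun t => ‖lyap sys K ^ t‖) (Z : Policy n n) :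
    HasSum (fun t => (lyap sys K ^ t) Z) (Ring.inverse (1 - lyap sys K) Z) := by
  rw [inverse_one_sub_of_summable hs]
  exact (ContinuousLinearMap.apply ℝ (Policy n n) Z).hasSum hs.of_norm.hasSum

lemma J_eq_trace_valueMat (h : IsStandardized ν Cn) (hK : K ∈ finiteCost sys ν) :
    J sys ν K = traceCLM n (valueMat sys K) := by
  rw [J_eq_tsum h]
  exact ((traceCLM n).hasSum
    (hasSum_lyap_pow_apply ((summable_norm_lyap_pow_iff h).1 hK) _)).tsum_eq

/-- On its domain the cost is the trace of a resolvent, and inversion is smooth at units. -/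
theorem contDiffOn_J (h : IsStandardized ν Cn) : ContDiffOn ℝ 2 (J sys ν) (finiteCost sys ν) := by
  have : ContDiffOn ℝ 2 (fun K => traceCLM n (valueMat sys K)) (finiteCost sys ν) := by
    intro K hK
    refine ContDiffAt.contDiffWithinAt ?_
    refine (traceCLM n).contDiff.contDiffAt.comp K ?_
    refine ContDiffAt.clm_apply ?_ (contDiff_costMatrix sys).contDiffAt
    obtain ⟨a, ha⟩ := isUnit_one_sub_of_summable ((summable_norm_lyap_pow_iff h).1 hK)
    have h1 := contDiffAt_ringInverse (n := 2) ℝ a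
    rw [ha] at h1
    exact h1.comp K (contDiff_const.sub (contDiff_lyap sys)).contDiffAt
  exact this.congr fun K hK => J_eq_trace_valueMat h hK

/-- Stage `0` alone costs at least `tr (Kᵀ R K)`. -/
lemma cost_lower_bound (h : IsStandardized ν Cn) (sys : System n m) :
    ∃ q, 0 < q ∧ ∀ K, ENNReal.ofReal (q * ‖K‖ ^ 2) ≤ cost sys ν K := by
  obtain ⟨q, hq, hq'⟩ := posDef_lower_bound sys.posDef_R
  refine ⟨q, hq, fun K => ?_⟩
  rw [cost_eq_tsum h]
  refine le_trans ?_ (ENNReal.le_tsum 0)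
  refine ENNReal.ofReal_le_ofReal ?_
  have h1 : costTerm sys K 0 = sys.Q.trace + (K.matᵀ * sys.R * K.mat).trace := by
    simp [costTerm, costMatrix]
  rw [h1, trace_transpose_mul_mul, Policy.norm_sq, frobSq_eq_sum_col, Finset.mul_sum]
  refine le_add_of_nonneg_of_le sys.posDef_Q.posSemidef.trace_nonneg ?_
  exact Finset.sum_le_sum fun j _ => hq' _

lemma J_pos (h : IsStandardized ν Cn) (hn : 0 < n) (hK : K ∈ finiteCost sys ν) :
    0 < J sys ν K := by
  have : Nonempty (Fin n) := ⟨⟨0, hn⟩⟩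
  rw [J_eq_tsum h]
  refine ((summable_costTerm_iff h).1 hK).tsum_pos (costTerm_nonneg sys K) 0 ?_
  simpa [costTerm] using (posDef_costMatrix sys K).trace_pos

/-- As a sum of nonnegative continuous terms, the cost is lower semicontinuous on the whole policy
space, with value `⊤` allowed, so sublevel sets are closed there and not only relative to the
domain. The quadratic lower bound makes them bounded. -/
theorem isCompact_sublevel (h : IsStandardized ν Cn) (sys : System n m) {c : ENNReal}
    (hc : c ≠ ⊤) : IsCompact {K | cost sys ν K ≤ c} := by
  have hlsc : LowerSemicontinuous (cost sys ν) := by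
    have : cost sys ν = fun K => ∑' t, ENNReal.ofReal (costTerm sys K t) :=
      funext (cost_eq_tsum h)
    rw [this]
    refine lowerSemicontinuous_tsum fun t => Continuous.lowerSemicontinuous ?_
    refine ENNReal.continuous_ofReal.comp ?_
    have h1 : Continuous fun K => (lyap sys K ^ t) (Policy.ofMat (costMatrix sys K)) :=
      ((contDiff_lyap sys).continuous.pow t).clm_apply (contDiff_costMatrix sys).continuous
    exact (traceCLM n).continuous.comp h1
  obtain ⟨q, hq, hq'⟩ := cost_lower_bound h sys
  refine Metric.isCompact_of_isClosed_isBounded (hlsc.isClosed_preimage c) ?_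
  refine (Metric.isBounded_iff_subset_closedBall 0).2 ⟨√(c.toReal / q), fun K hK => ?_⟩
  rw [mem_closedBall_zero_iff]
  refine Real.le_sqrt_of_sq_le ?_
  rw [le_div_iff₀' hq]
  exact (ENNReal.ofReal_le_iff_le_toReal hc).1 ((hq' K).trans hK)

theorem exists_isOptimal (h : IsStandardized ν Cn) (hK : K ∈ finiteCost sys ν) :
    ∃ Kstar, IsOptimal sys ν Kstar := by
  have hcomp := isCompact_sublevel h sys (c := cost sys ν K) hK
  have hsub : {K' | cost sys ν K' ≤ cost sys ν K} ⊆ finiteCost sys ν :=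
    fun K' hK' => ne_top_of_le_ne_top hK hK'
  obtain ⟨Kstar, hs, hmin⟩ := hcomp.exists_isMinOn ⟨K, le_refl (cost sys ν K)⟩
    ((contDiffOn_J h).continuousOn.mono hsub)
  refine ⟨Kstar, fun K' => ?_⟩
  rcases le_total (cost sys ν K') (cost sys ν K) with h' | h'
  · exact (ENNReal.toReal_le_toReal (hsub hs) (hsub h')).1 (hmin h')
  · exact le_trans hs h'

end Cost

/-! ### Performance difference and gradient dominance -/

section GradientDominance
variable {sys : System n m} {ν : Measure (State n)} {Cn : ℝ} {K K' : Policy n m}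

/-- The matrix `(R + γ Bᵀ P B) K - γ Bᵀ P A`. -/
def gradMat (sys : System n m) (K : Policy n m) : Matrix (Fin m) (Fin n) ℝ :=
  sys.R * K.mat - sys.γ • (sys.Bᵀ * (valueMat sys K).mat * closedLoop sys K)

/-- The change of the value of `K` after one step with the policy `K'`. -/
def bellmanResidual (sys : System n m) (K K' : Policy n m) : Policy n n :=
  Policy.ofMat (costMatrix sys K') + lyap sys K' (valueMat sys K) - valueMat sys K

lemma valueMat_eq (hs : Summable fun t => ‖lyap sys K ^ t‖) :
    valueMat sys K = Policy.ofMat (costMatrix sys K) + lyap sys K (valueMat sys K) := by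
  have h1 := Ring.mul_inverse_cancel _ (isUnit_one_sub_of_summable hs)
  have h2 := congrArg (fun a : Policy n n →L[ℝ] Policy n n => a (Policy.ofMat (costMatrix sys K))) h1
  simp only [mul_apply_eq_comp, one_apply_eq_self, sub_apply] at h2
  exact sub_eq_iff_eq_add.1 h2

lemma valueMat_symm (hs : Summable fun t => ‖lyap sys K ^ t‖) :
    (valueMat sys K).matᵀ = (valueMat sys K).mat := by
  have h := hasSum_lyap_pow_apply hs (Policy.ofMat (costMatrix sys K))
  have hp : ∀ p : Fin n × Fin n, HasSum
      (fun t => ((lyap sys K ^ t) (Policy.ofMat (costMatrix sys K))) p) (valueMat sys K p) :=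
    fun p => (EuclideanSpace.proj (𝕜 := ℝ) p : Policy n n →L[ℝ] ℝ).hasSum h
  ext i j
  have hsymm : ∀ t, ((lyap sys K ^ t) (Policy.ofMat (costMatrix sys K))) (j, i) =
      ((lyap sys K ^ t) (Policy.ofMat (costMatrix sys K))) (i, j) := fun t => by
    have := (posSemidef_lyap_pow sys K t (Z := Policy.ofMat (costMatrix sys K))
      (posDef_costMatrix sys K).posSemidef).isHermitian.apply i j
    rwa [star_trivial] at this
  have h1 := hp (j, i)
  simp only [hsymm] at h1
  exact h1.unique (hp (i, j))

lemma valueMat_nonneg (hs : Summable fun t => ‖lyap sys K ^ t‖) (x : Fin n → ℝ) :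
    0 ≤ x ⬝ᵥ (valueMat sys K).mat *ᵥ x := by
  have h := hasSum_lyap_pow_apply hs (Policy.ofMat (costMatrix sys K))
  let q : Policy n n →L[ℝ] ℝ := LinearMap.toContinuousLinearMap
    { toFun := fun Z => x ⬝ᵥ Z.mat *ᵥ x
      map_add' := fun Y Z => by simp [Matrix.add_mulVec]
      map_smul' := fun c Z => by simp [Matrix.smul_mulVec] }
  refine (q.hasSum h).nonneg fun t => ?_
  have := (posSemidef_lyap_pow sys K t (Z := Policy.ofMat (costMatrix sys K))
    (posDef_costMatrix sys K).posSemidef).dotProduct_mulVec_nonneg x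
  rwa [star_trivial] at this

lemma dotProduct_mulVec_comm_of_symm {ι : Type*} [Fintype ι] {Z : Matrix ι ι ℝ} (hZ : Zᵀ = Z)
    (u v : ι → ℝ) : u ⬝ᵥ Z *ᵥ v = v ⬝ᵥ Z *ᵥ u := by
  rw [Matrix.dotProduct_mulVec, ← Matrix.mulVec_transpose, hZ, dotProduct_comm]

/-- Expansion in `V = K' - K`: the closed loop changes by `-B V`, and the fixed-point equation of
the value matrix cancels the terms of order zero. -/
lemma quadForm_bellmanResidual (hs : Summable fun t => ‖lyap sys K ^ t‖) (y : Fin n → ℝ) :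
    y ⬝ᵥ (bellmanResidual sys K K').mat *ᵥ y =
      2 * (((K' - K).mat *ᵥ y) ⬝ᵥ (gradMat sys K *ᵥ y)) +
      ((K' - K).mat *ᵥ y) ⬝ᵥ sys.R *ᵥ ((K' - K).mat *ᵥ y) +
      sys.γ * ((sys.B *ᵥ ((K' - K).mat *ᵥ y)) ⬝ᵥ
        (valueMat sys K).mat *ᵥ (sys.B *ᵥ ((K' - K).mat *ᵥ y))) := by
  have hP := valueMat_symm hs
  have hR : sys.Rᵀ = sys.R := by simpa using sys.posDef_R.isHermitian.eq
  have hval : y ⬝ᵥ (valueMat sys K).mat *ᵥ y = y ⬝ᵥ (costMatrix sys K) *ᵥ y +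
      sys.γ * ((closedLoop sys K *ᵥ y) ⬝ᵥ (valueMat sys K).mat *ᵥ (closedLoop sys K *ᵥ y)) := by
    conv_lhs => rw [valueMat_eq hs]
    rw [Policy.mat_add, Matrix.add_mulVec, dotProduct_add, mat_lyap, Matrix.smul_mulVec,
      dotProduct_smul, dotProduct_transpose_mul_mul, Policy.mat_ofMat, smul_eq_mul]
  have hres : y ⬝ᵥ (bellmanResidual sys K K').mat *ᵥ y = y ⬝ᵥ (costMatrix sys K') *ᵥ y +
      sys.γ * ((closedLoop sys K' *ᵥ y) ⬝ᵥ (valueMat sys K).mat *ᵥ (closedLoop sys K' *ᵥ y)) -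
      y ⬝ᵥ (valueMat sys K).mat *ᵥ y := by
    rw [bellmanResidual, Policy.mat_sub, Policy.mat_add, Matrix.sub_mulVec, Matrix.add_mulVec,
      dotProduct_sub, dotProduct_add, mat_lyap, Matrix.smul_mulVec, dotProduct_smul,
      dotProduct_transpose_mul_mul, Policy.mat_ofMat, smul_eq_mul]
  have hcl : closedLoop sys K' *ᵥ y =
      closedLoop sys K *ᵥ y - sys.B *ᵥ ((K' - K).mat *ᵥ y) := by
    simp only [closedLoop, Matrix.sub_mulVec, Policy.mat_sub, Matrix.mulVec_sub,
      Matrix.mulVec_mulVec]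
    abel
  have hKK : K'.mat *ᵥ y = K.mat *ᵥ y + (K' - K).mat *ᵥ y := by
    simp [Matrix.sub_mulVec]
  have hcost : ∀ K : Policy n m, y ⬝ᵥ (costMatrix sys K) *ᵥ y =
      y ⬝ᵥ sys.Q *ᵥ y + (K.mat *ᵥ y) ⬝ᵥ sys.R *ᵥ (K.mat *ᵥ y) := fun K => by
    rw [costMatrix, Matrix.add_mulVec, dotProduct_add, dotProduct_transpose_mul_mul]
  have hgrad : gradMat sys K *ᵥ y = sys.R *ᵥ (K.mat *ᵥ y) -
      sys.γ • (sys.Bᵀ *ᵥ ((valueMat sys K).mat *ᵥ (closedLoop sys K *ᵥ y))) := by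
    rw [gradMat, Matrix.sub_mulVec, Matrix.smul_mulVec, Matrix.mulVec_mulVec, Matrix.mulVec_mulVec,
      Matrix.mulVec_mulVec]
  rw [hres, hval, hcost, hcost, hcl, hKK, hgrad]
  generalize (K' - K).mat *ᵥ y = v
  generalize K.mat *ᵥ y = a
  generalize closedLoop sys K *ᵥ y = z
  have h1 : v ⬝ᵥ (sys.Bᵀ *ᵥ ((valueMat sys K).mat *ᵥ z)) =
      (sys.B *ᵥ v) ⬝ᵥ (valueMat sys K).mat *ᵥ z := by
    rw [Matrix.dotProduct_mulVec, Matrix.vecMul_transpose]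
  have h2 := dotProduct_mulVec_comm_of_symm hP z (sys.B *ᵥ v)
  have h3 := dotProduct_mulVec_comm_of_symm hR a v
  simp only [dotProduct_sub, dotProduct_add, sub_dotProduct, add_dotProduct, Matrix.mulVec_sub,
    Matrix.mulVec_add, dotProduct_smul, smul_eq_mul, h1, h2, h3]
  ring

/-- The performance difference of two policies of finite cost. -/
lemma hasSum_J_sub_J (h : IsStandardized ν Cn) (hK : K ∈ finiteCost sys ν)
    (hK' : K' ∈ finiteCost sys ν) :
    HasSum (fun t => ((lyap sys K' ^ t) (bellmanResidual sys K K')).mat.trace)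
      (J sys ν K' - J sys ν K) := by
  have hs' := (summable_norm_lyap_pow_iff h).1 hK'
  have h1 := Ring.inverse_mul_cancel _ (isUnit_one_sub_of_summable hs')
  have h2 := congrArg (fun a : Policy n n →L[ℝ] Policy n n => a (valueMat sys K)) h1
  simp only [mul_apply_eq_comp, one_apply_eq_self, sub_apply, map_sub] at h2
  -- The residual is the cost matrix of `K'` minus `(1 - lyap sys K')` applied to the value of `K`,
  -- so the resolvent of `K'` maps it to the difference of the values.
  have h3 : Ring.inverse (1 - lyap sys K') (bellmanResidual sys K K') =
      valueMat sys K' - valueMat sys K := by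
    rw [bellmanResidual, add_sub_assoc, map_add, map_sub]
    rw [← neg_sub (Ring.inverse (1 - lyap sys K') (valueMat sys K)), h2, ← sub_eq_add_neg]
    rfl
  rw [J_eq_trace_valueMat h hK, J_eq_trace_valueMat h hK', ← map_sub, ← h3]
  exact (traceCLM n).hasSum (hasSum_lyap_pow_apply hs' _)

lemma summable_frobSq (h : IsStandardized ν Cn) (hK : K ∈ finiteCost sys ν) :
    Summable fun t => sys.γ ^ t * frobSq (closedLoop sys K ^ t) := by
  obtain ⟨q, hq, hq'⟩ := posDef_lower_bound (posDef_costMatrix sys K)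
  refine Summable.of_nonneg_of_le
    (fun t => mul_nonneg (pow_nonneg sys.γ_pos.le t) (frobSq_nonneg _)) (fun t => ?_)
    (((summable_costTerm_iff h).1 hK).mul_left q⁻¹)
  rw [← div_eq_inv_mul, le_div_iff₀' hq]
  exact mul_frobSq_le_trace_lyap_pow sys K t (Policy.ofMat (costMatrix sys K)) q hq'

/-- Minimizing the residual form over the change of control bounds it below, uniformly in `K'`; only
the closed loop of `K'` remains in the sum. -/
lemma J_sub_J_le (h : IsStandardized ν Cn) (hK : K ∈ finiteCost sys ν)
    (hK' : K' ∈ finiteCost sys ν) {q : ℝ} (hq : 0 < q)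
    (hR : ∀ x : Fin m → ℝ, q * (x ⬝ᵥ x) ≤ x ⬝ᵥ sys.R *ᵥ x) :
    J sys ν K - J sys ν K' ≤
      frobSq (gradMat sys K) / q * ∑' t, sys.γ ^ t * frobSq (closedLoop sys K' ^ t) := by
  have hs := (summable_norm_lyap_pow_iff h).1 hK
  have hform : ∀ y : Fin n → ℝ, -(frobSq (gradMat sys K) / q) * (y ⬝ᵥ y) ≤
      y ⬝ᵥ (bellmanResidual sys K K').mat *ᵥ y := by
    intro y
    rw [quadForm_bellmanResidual hs]
    have h1 := dotProduct_mulVec_self_le (gradMat sys K) y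
    have h2 := mul_nonneg sys.γ_pos.le
      (valueMat_nonneg hs (sys.B *ᵥ ((K' - K).mat *ᵥ y)))
    have h3 := hR ((K' - K).mat *ᵥ y)
    generalize (K' - K).mat *ᵥ y = v at *
    generalize gradMat sys K *ᵥ y = e at *
    -- Completing the square in `q (v ⬝ᵥ v) + 2 (v ⬝ᵥ e)`, whose minimizer is `v = -q⁻¹ e`.
    have h4 : 0 ≤ (v + q⁻¹ • e) ⬝ᵥ (v + q⁻¹ • e) := by
      simpa using dotProduct_star_self_nonneg (v + q⁻¹ • e)
    simp only [add_dotProduct, dotProduct_add, smul_dotProduct, dotProduct_smul, smul_eq_mul,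
      dotProduct_comm e v] at h4
    have h5 : 0 ≤ q * (v ⬝ᵥ v) + 2 * (v ⬝ᵥ e) + q⁻¹ * (e ⬝ᵥ e) := by
      have := mul_nonneg hq.le h4
      field_simp at this ⊢
      linarith
    have h6 : q⁻¹ * (e ⬝ᵥ e) ≤ frobSq (gradMat sys K) / q * (y ⬝ᵥ y) := by
      rw [div_mul_eq_mul_div, ← div_eq_inv_mul]
      gcongr
    linarith
  have h1 := hasSum_le
    (fun t => mul_frobSq_le_trace_lyap_pow sys K' t (bellmanResidual sys K K') _ hform)
    ((summable_frobSq h hK').hasSum.mul_left _) (hasSum_J_sub_J h hK hK')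
  linarith

/-- Along `gradMat` the linear term of the residual form is a square and the quadratic terms are
nonnegative, so the cost rises at least linearly in `s`. -/
lemma le_J_sub_J (h : IsStandardized ν Cn) (hK : K ∈ finiteCost sys ν) {s : ℝ} (hs0 : 0 ≤ s)
    (hK' : K + s • Policy.ofMat (gradMat sys K) ∈ finiteCost sys ν) :
    2 * s * frobSq (gradMat sys K) ≤
      J sys ν (K + s • Policy.ofMat (gradMat sys K)) - J sys ν K := by
  set K' := K + s • Policy.ofMat (gradMat sys K) with hdef
  have hs := (summable_norm_lyap_pow_iff h).1 hK
  have hV : (K' - K).mat = s • gradMat sys K := by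
    rw [hdef, add_sub_cancel_left, Policy.mat_smul, Policy.mat_ofMat]
  have hform : ∀ y : Fin n → ℝ, 2 * s * ((gradMat sys K *ᵥ y) ⬝ᵥ (gradMat sys K *ᵥ y)) ≤
      y ⬝ᵥ (bellmanResidual sys K K').mat *ᵥ y := by
    intro y
    rw [quadForm_bellmanResidual hs]
    have h2 := mul_nonneg sys.γ_pos.le
      (valueMat_nonneg hs (sys.B *ᵥ ((K' - K).mat *ᵥ y)))
    have h3 := sys.posDef_R.posSemidef.dotProduct_mulVec_nonneg ((K' - K).mat *ᵥ y)
    simp only [star_trivial] at h3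
    have h4 : ((K' - K).mat *ᵥ y) ⬝ᵥ (gradMat sys K *ᵥ y) =
        s * ((gradMat sys K *ᵥ y) ⬝ᵥ (gradMat sys K *ᵥ y)) := by
      rw [hV, Matrix.smul_mulVec, smul_dotProduct, smul_eq_mul]
    rw [h4]
    linarith
  have hself : ∀ v : Fin m → ℝ, 0 ≤ v ⬝ᵥ v := fun v => by
    simpa using dotProduct_star_self_nonneg v
  have hsum := hasSum_J_sub_J h hK hK'
  -- All stages contribute nonnegatively; stage `0`, where the state covariance is the identity,
  -- already gives the bound.
  have h0 := hsum.summable.le_tsum 0 (fun t _ => by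
    have := mul_frobSq_le_trace_lyap_pow sys K' t (bellmanResidual sys K K') 0 (fun x => by
      have := hform x
      have := mul_nonneg (mul_nonneg zero_le_two hs0) (hself (gradMat sys K *ᵥ x))
      linarith)
    simpa using this)
  rw [hsum.tsum_eq] at h0
  refine le_trans ?_ h0
  have h1 := trace_transpose_mul_mul (bellmanResidual sys K K').mat
    (1 : Matrix (Fin n) (Fin n) ℝ)
  rw [Matrix.transpose_one, Matrix.one_mul, Matrix.mul_one] at h1
  rw [pow_zero, one_apply_eq_self, h1, frobSq_eq_sum_col, Finset.mul_sum]
  refine Finset.sum_le_sum fun j _ => ?_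
  refine le_trans (le_of_eq ?_) (hform _)
  have : (gradMat sys K *ᵥ fun i => (1 : Matrix (Fin n) (Fin n) ℝ) i j) =
      fun i => gradMat sys K i j := by
    ext i
    simp [Matrix.mulVec, dotProduct, Matrix.one_apply]
  rw [this]

lemma differentiableAt_J (h : IsStandardized ν Cn) (hK : K ∈ finiteCost sys ν) :
    DifferentiableAt ℝ (J sys ν) K :=
  ((contDiffOn_J h).contDiffAt ((isOpen_finiteCost h).mem_nhds hK)).differentiableAt two_ne_zero

lemma inner_gradient_J (sys : System n m) (ν : Measure (State n)) (K v : Policy n m) :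
    fderiv ℝ (J sys ν) K v = inner ℝ (gradient (J sys ν) K) v := by
  rw [gradient, InnerProductSpace.toDual_symm_apply]

/-- The linear growth along `E` bounds the one-sided derivative by `2 ‖E‖ ^ 2` from below, and
Cauchy-Schwarz gives `2 ‖E‖ ≤ ‖∇J‖`, without a formula for the gradient. -/
lemma four_mul_frobSq_le (h : IsStandardized ν Cn) (hK : K ∈ finiteCost sys ν) :
    4 * frobSq (gradMat sys K) ≤ ‖gradient (J sys ν) K‖ ^ 2 := by
  set E : Policy n m := Policy.ofMat (gradMat sys K) with hE
  have hEn : ‖E‖ ^ 2 = frobSq (gradMat sys K) := Policy.norm_sq E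
  have hline : HasDerivAt (fun s : ℝ => K + s • E) E 0 := by
    simpa using ((hasDerivAt_id (0 : ℝ)).smul_const E).const_add K
  have hd : HasDerivAt (fun s : ℝ => J sys ν (K + s • E)) (inner ℝ (gradient (J sys ν) K) E) 0 := by
    rw [← inner_gradient_J sys ν]
    have h1 : HasFDerivAt (J sys ν) (fderiv ℝ (J sys ν) K) (K + (0 : ℝ) • E) := by
      simpa using (differentiableAt_J h hK).hasFDerivAt
    exact h1.comp_hasDerivAt 0 hline
  have hmem : ∀ᶠ s : ℝ in nhdsWithin 0 (Set.Ioi 0), K + s • E ∈ finiteCost sys ν := by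
    refine Filter.Eventually.filter_mono nhdsWithin_le_nhds ?_
    refine hline.continuousAt.eventually_mem ((isOpen_finiteCost h).mem_nhds ?_)
    simpa using hK
  have hge : 2 * ‖E‖ ^ 2 ≤ inner ℝ (gradient (J sys ν) K) E := by
    refine ge_of_tendsto hd.tendsto_slope_zero_right ?_
    filter_upwards [hmem, self_mem_nhdsWithin] with s hs hs0
    have hs0' : 0 < s := hs0
    have := le_J_sub_J h hK hs0'.le hs
    simp only [zero_add, zero_smul, add_zero, smul_eq_mul]
    rw [← div_eq_inv_mul, le_div_iff₀ hs0', hEn]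
    linarith
  have hcs := real_inner_le_norm (gradient (J sys ν) K) E
  rw [← hEn]
  rcases eq_or_lt_of_le (norm_nonneg E) with h0 | h0
  · rw [← h0]; simp
  · have : 2 * ‖E‖ ≤ ‖gradient (J sys ν) K‖ := by nlinarith
    nlinarith

lemma IsOptimal.mem_finiteCost {Kstar : Policy n m} (hopt : IsOptimal sys ν Kstar)
    (hK : K ∈ finiteCost sys ν) : Kstar ∈ finiteCost sys ν :=
  ne_top_of_le_ne_top hK (hopt K)

lemma IsOptimal.J_le {Kstar : Policy n m} (hopt : IsOptimal sys ν Kstar)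
    (hK : K ∈ finiteCost sys ν) : J sys ν Kstar ≤ J sys ν K :=
  ENNReal.toReal_mono hK (hopt K)

/-- The cost of the linear quadratic regulator is gradient dominated. -/
theorem exists_isPL (h : IsStandardized ν Cn) {Kstar : Policy n m}
    (hstar : Kstar ∈ finiteCost sys ν) : ∃ μ, 0 < μ ∧ IsPL sys ν Kstar μ := by
  obtain ⟨q, hq, hR⟩ := posDef_lower_bound sys.posDef_R
  set S := ∑' t, sys.γ ^ t * frobSq (closedLoop sys Kstar ^ t) with hS
  have hS0 : 0 ≤ S :=
    tsum_nonneg fun t => mul_nonneg (pow_nonneg sys.γ_pos.le t) (frobSq_nonneg _)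
  -- The quotient of the two bounds is `4 q / S`; `S + 1` keeps the denominator positive.
  refine ⟨4 * q / (S + 1), by positivity, fun K hK => ?_⟩
  have h1 := J_sub_J_le h hK hstar hq hR
  have h2 := four_mul_frobSq_le h hK
  have h3 := frobSq_nonneg (gradMat sys K)
  calc _ ≤ 4 * q / (S + 1) * (frobSq (gradMat sys K) / q * (S + 1)) := by
        gcongr
        refine h1.trans ?_
        gcongr
        linarith
    _ = 4 * frobSq (gradMat sys K) := by field_simp
    _ ≤ _ := h2

end GradientDominance

/-! ### Curvature parameters from compactness -/

section Curvature

/-- A `C¹` function on an open set is Lipschitz near the points of a compact subset, with a uniform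
constant and on balls of a uniform radius. -/
lemma exists_uniform_lipschitz {E F : Type*} [NormedAddCommGroup E] [NormedSpace ℝ E]
    [FiniteDimensional ℝ E] [NormedAddCommGroup F] [NormedSpace ℝ F] {f : E → F} {S T : Set E}
    (hS : IsOpen S) (hf : ContDiffOn ℝ 1 f S) (hT : IsCompact T) (hTS : T ⊆ S) :
    ∃ δ c : ℝ, 0 < δ ∧ 0 < c ∧ ∀ K ∈ T, ∀ K', ‖K' - K‖ ≤ δ →
      K' ∈ S ∧ ‖f K' - f K‖ ≤ c * ‖K' - K‖ := by
  -- A closed thickening of `T` inside `S` is still compact, so it bounds the derivative; the mean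
  -- value inequality then applies on each ball, which is convex.
  obtain ⟨δ, hδ, hsub⟩ := hT.exists_cthickening_subset_open hS hTS
  have hcont : ContinuousOn (fderiv ℝ f) S := hf.continuousOn_fderiv_of_isOpen hS le_rfl
  obtain ⟨c, hc⟩ := (hT.cthickening (r := δ)).exists_bound_of_continuousOn (hcont.mono hsub)
  have hball : ∀ K ∈ T, ∀ K', ‖K' - K‖ ≤ δ → K' ∈ Metric.cthickening δ T := fun K hK K' hK' =>
    Metric.mem_cthickening_of_dist_le K' K δ T hK (by rwa [dist_eq_norm])
  refine ⟨δ, max c 1, hδ, by positivity, fun K hK K' hK' => ⟨hsub (hball K hK K' hK'), ?_⟩⟩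
  refine (convex_closedBall K δ).norm_image_sub_le_of_norm_fderiv_le (𝕜 := ℝ) (fun y hy => ?_)
    (fun y hy => ?_) (Metric.mem_closedBall_self hδ.le) ?_
  · rw [mem_closedBall_iff_norm] at hy
    exact (hf.contDiffAt (hS.mem_nhds (hsub (hball K hK y hy)))).differentiableAt one_ne_zero
  · rw [mem_closedBall_iff_norm] at hy
    exact (hc y (hball K hK y hy)).trans (le_max_left _ _)
  · rwa [mem_closedBall_iff_norm]

variable {sys : System n m} {ν : Measure (State n)} {Cn : ℝ} {K K₀ Kstar : Policy n m}

lemma norm_gradient_sub (f : Policy n m → ℝ) (K K' : Policy n m) :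
    ‖gradient f K' - gradient f K‖ = ‖fderiv ℝ f K' - fderiv ℝ f K‖ := by
  rw [gradient, gradient, ← map_sub, LinearIsometryEquiv.norm_map]

lemma exists_uniform_curvature (h : IsStandardized ν Cn) {T : Set (Policy n m)}
    (hT : IsCompact T) (hTS : T ⊆ finiteCost sys ν) :
    ∃ δ φ L : ℝ, 0 < δ ∧ 0 < φ ∧ 0 < L ∧ ∀ K ∈ T,
      IsLocallySmoothAt sys ν φ δ K ∧ IsLocallyLipschitzAt sys ν L δ K := by
  have hS := isOpen_finiteCost (sys := sys) h
  have hJ := contDiffOn_J (sys := sys) h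
  obtain ⟨δ₁, φ, hδ₁, hφ, h₁⟩ := exists_uniform_lipschitz hS
    (hJ.fderiv_of_isOpen (m := 1) hS (by norm_num)) hT hTS
  obtain ⟨δ₂, L, hδ₂, hL, h₂⟩ := exists_uniform_lipschitz hS (hJ.of_le (by norm_num)) hT hTS
  refine ⟨min δ₁ δ₂, φ, L, lt_min hδ₁ hδ₂, hφ, hL, fun K hK => ⟨fun K' hK' => ?_, fun K' hK' => ?_⟩⟩
  · rw [norm_gradient_sub]
    exact h₁ K hK K' (hK'.trans (min_le_left _ _))
  · exact h₂ K hK K' (hK'.trans (min_le_right _ _))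

lemma initGap_nonneg (hopt : IsOptimal sys ν Kstar) (hK₀ : K₀ ∈ finiteCost sys ν) :
    0 ≤ initGap sys ν K₀ Kstar :=
  sub_nonneg.2 (hopt.J_le hK₀)

lemma mem_boundedSet_self (hopt : IsOptimal sys ν Kstar) (hK₀ : K₀ ∈ finiteCost sys ν) :
    K₀ ∈ boundedSet sys ν K₀ Kstar := by
  have := initGap_nonneg hopt hK₀
  refine ⟨hK₀, ?_⟩
  rw [← initGap]
  linarith

lemma isCompact_boundedSet (h : IsStandardized ν Cn) :
    IsCompact (boundedSet sys ν K₀ Kstar) := by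
  set c := J sys ν Kstar + 10 * initGap sys ν K₀ Kstar with hc
  -- A negative level would be truncated to `0` in `ENNReal`; the set is then empty.
  rcases lt_or_ge c 0 with h0 | h0
  · convert isCompact_empty
    refine Set.eq_empty_of_forall_notMem fun K hK => ?_
    have : 0 ≤ J sys ν K := ENNReal.toReal_nonneg
    linarith [hK.2]
  · convert isCompact_sublevel h sys (c := ENNReal.ofReal c) ENNReal.ofReal_ne_top using 1
    ext K
    constructor
    · rintro ⟨hK, hK'⟩
      refine (ENNReal.le_ofReal_iff_toReal_le hK h0).2 ?_
      have : J sys ν K ≤ c := by linarith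
      exact this
    · intro hK
      have hfin : cost sys ν K ≠ ⊤ := ne_top_of_le_ne_top ENNReal.ofReal_ne_top hK
      have : J sys ν K ≤ c := (ENNReal.le_ofReal_iff_toReal_le hfin h0).1 hK
      exact ⟨hfin, by linarith⟩

theorem exists_isCurvature (h : IsStandardized ν Cn) (hK₀ : K₀ ∈ finiteCost sys ν)
    (hopt : IsOptimal sys ν Kstar) :
    ∃ φ L ρ μ : ℝ, IsCurvature sys ν K₀ Kstar φ L ρ μ := by
  classical
  obtain ⟨μ, hμ, hPL⟩ := exists_isPL h (hopt.mem_finiteCost hK₀)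
  obtain ⟨δ, φ, L, hδ, hφ, hL, hG⟩ := exists_uniform_curvature h
    (isCompact_boundedSet (K₀ := K₀) (Kstar := Kstar) h) fun K hK => hK.1
  have hloc : ∀ K : Policy n m, ∃ δ φ L : ℝ, K ∈ finiteCost sys ν → 0 < δ ∧ 0 < φ ∧ 0 < L ∧
      IsLocallySmoothAt sys ν φ δ K ∧ IsLocallyLipschitzAt sys ν L δ K := by
    intro K
    by_cases hK : K ∈ finiteCost sys ν
    · obtain ⟨δ, φ, L, h1, h2, h3, h4⟩ := exists_uniform_curvature h isCompact_singleton
        (Set.singleton_subset_iff.2 hK)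
      exact ⟨δ, φ, L, fun _ => ⟨h1, h2, h3, h4 K rfl⟩⟩
    · exact ⟨1, 1, 1, fun hK' => absurd hK' hK⟩
  choose δ' φ' L' hloc using hloc
  set G := boundedSet sys ν K₀ Kstar with hGdef
  have hne : G.Nonempty := ⟨K₀, mem_boundedSet_self hopt hK₀⟩
  -- The parameters are constant on the bounded set, which makes the suprema and the infimum
  -- trivial, and arbitrary local ones elsewhere.
  refine ⟨φ, L, δ, μ, hμ, hPL, hδ, fun K => if K ∈ G then φ else φ' K,
    fun K => if K ∈ G then δ else δ' K, fun K => if K ∈ G then L else L' K,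
    fun K => if K ∈ G then δ else δ' K, fun K hK => ?_, ?_, ?_, ?_⟩
  · by_cases hKG : K ∈ G
    · simp only [hKG, if_true]
      exact ⟨hφ, hδ, hL, hδ, hG K hKG⟩
    · simp only [hKG, if_false]
      obtain ⟨h1, h2, h3, h4⟩ := hloc K hK
      exact ⟨h2, h1, h3, h1, h4⟩
  · rw [Set.image_congr (g := fun _ => φ) fun K hK => if_pos hK, hne.image_const]
    exact isLUB_singleton
  · rw [Set.image_congr (g := fun _ => L) fun K hK => if_pos hK, hne.image_const]
    exact isLUB_singleton
  · rw [Set.image_congr (g := fun _ => δ) fun K hK => by simp [show K ∈ G from hK], hne.image_const]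
    exact isGLB_singleton

/-- What the analysis uses of the curvature parameters on the bounded set. -/
structure CurvatureBounds (sys : System n m) (ν : Measure (State n)) (K₀ Kstar : Policy n m)
    (φ L ρ μ : ℝ) : Prop where
  φ_pos : 0 < φ
  L_pos : 0 < L
  ρ_pos : 0 < ρ
  μ_pos : 0 < μ
  pl : IsPL sys ν Kstar μ
  smooth : ∀ K ∈ boundedSet sys ν K₀ Kstar, IsLocallySmoothAt sys ν φ ρ K
  lipschitz : ∀ K ∈ boundedSet sys ν K₀ Kstar, IsLocallyLipschitzAt sys ν L ρ K

lemma IsCurvature.bounds {φ L ρ μ : ℝ} (hK₀ : K₀ ∈ finiteCost sys ν)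
    (hopt : IsOptimal sys ν Kstar) (hc : IsCurvature sys ν K₀ Kstar φ L ρ μ) :
    CurvatureBounds sys ν K₀ Kstar φ L ρ μ := by
  obtain ⟨hμ, hPL, hρ, φK, βK, LK, ζK, hloc, hφ, hL, hglb⟩ := hc
  have hmem := mem_boundedSet_self hopt hK₀
  have hφle : ∀ K ∈ boundedSet sys ν K₀ Kstar, φK K ≤ φ := fun K hK => hφ.1 ⟨K, hK, rfl⟩
  have hLle : ∀ K ∈ boundedSet sys ν K₀ Kstar, LK K ≤ L := fun K hK => hL.1 ⟨K, hK, rfl⟩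
  have hρle : ∀ K ∈ boundedSet sys ν K₀ Kstar, ρ ≤ min (βK K) (ζK K) :=
    fun K hK => hglb.1 ⟨K, hK, rfl⟩
  refine ⟨(hloc K₀ hK₀).1.trans_le (hφle _ hmem), (hloc K₀ hK₀).2.2.1.trans_le (hLle _ hmem), hρ,
    hμ, hPL, fun K hK K' hK' => ?_, fun K hK K' hK' => ?_⟩
  · obtain ⟨h1, h2⟩ := (hloc K hK.1).2.2.2.2.1 K'
      (hK'.trans ((hρle K hK).trans (min_le_left _ _)))
    exact ⟨h1, h2.trans (by gcongr; exact hφle K hK)⟩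
  · obtain ⟨h1, h2⟩ := (hloc K hK.1).2.2.2.2.2 K'
      (hK'.trans ((hρle K hK).trans (min_le_right _ _)))
    exact ⟨h1, h2.trans (by gcongr; exact hLle K hK)⟩

end Curvature

/-! ### Descent inequality and bias of the one-point estimate -/

section Descent
variable {sys : System n m} {ν : Measure (State n)} {Cn : ℝ} {K K₀ Kstar : Policy n m}
  {φ L ρ μ : ℝ}

lemma hasDerivAt_J_line (h : IsStandardized ν Cn) {v : Policy n m} {s : ℝ}
    (hK : K + s • v ∈ finiteCost sys ν) :
    HasDerivAt (fun s : ℝ => J sys ν (K + s • v))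
      (inner ℝ (gradient (J sys ν) (K + s • v)) v) s := by
  have hline : HasDerivAt (fun s : ℝ => K + s • v) v s := by
    simpa using ((hasDerivAt_id s).smul_const v).const_add K
  rw [← inner_gradient_J]
  exact (differentiableAt_J h hK).hasFDerivAt.comp_hasDerivAt s hline

/-- Along the segment, `J` minus its quadratic majorant has nonpositive derivative. -/
lemma IsLocallySmoothAt.descent (h : IsStandardized ν Cn)
    (hs : IsLocallySmoothAt sys ν φ ρ K) {v : Policy n m} (hv : ‖v‖ ≤ ρ) :
    J sys ν (K + v) ≤ J sys ν K + inner ℝ (gradient (J sys ν) K) v + φ / 2 * ‖v‖ ^ 2 := by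
  set g := gradient (J sys ν) K with hg
  have hseg : ∀ s ∈ Set.Icc (0 : ℝ) 1, ‖(K + s • v) - K‖ ≤ ρ := fun s hs' => by
    rw [add_sub_cancel_left, norm_smul, Real.norm_of_nonneg hs'.1]
    exact (mul_le_of_le_one_left (norm_nonneg _) hs'.2).trans hv
  have hderiv : ∀ s ∈ Set.Icc (0 : ℝ) 1, HasDerivAt
      (fun s : ℝ => J sys ν (K + s • v) - s * inner ℝ g v - φ / 2 * ‖v‖ ^ 2 * s ^ 2)
      (inner ℝ (gradient (J sys ν) (K + s • v)) v - inner ℝ g v - φ * ‖v‖ ^ 2 * s) s := by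
    intro s hs'
    have h1 := hasDerivAt_J_line h (hs _ (hseg s hs')).1
    have h2 := (hasDerivAt_id s).mul_const (inner ℝ g v)
    have h3 := ((hasDerivAt_id s).pow 2).const_mul (φ / 2 * ‖v‖ ^ 2)
    refine ((h1.sub h2).sub h3).congr_deriv ?_
    simp
    ring
  have hanti : AntitoneOn
      (fun s : ℝ => J sys ν (K + s • v) - s * inner ℝ g v - φ / 2 * ‖v‖ ^ 2 * s ^ 2)
      (Set.Icc 0 1) := by
    refine antitoneOn_of_deriv_nonpos (convex_Icc 0 1)
      (fun s hs' => (hderiv s hs').continuousAt.continuousWithinAt)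
      (fun s hs' => (hderiv s (interior_subset hs')).differentiableAt.differentiableWithinAt)
      (fun s hs' => ?_)
    have hs'' := interior_subset hs'
    rw [(hderiv s hs'').deriv, ← inner_sub_left]
    have h1 := real_inner_le_norm (gradient (J sys ν) (K + s • v) - g) v
    have h2 := (hs _ (hseg s hs'')).2
    rw [add_sub_cancel_left, norm_smul, Real.norm_of_nonneg hs''.1] at h2
    nlinarith [norm_nonneg v]
  have := hanti (Set.left_mem_Icc.2 zero_le_one) (Set.right_mem_Icc.2 zero_le_one) zero_le_one
  simp only [one_smul, zero_smul, add_zero, one_mul, zero_mul, one_pow, mul_one] at this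
  linarith

/-- On the ball of radius `r` the gradient varies by at most `φ r` from its value at the center, so
`J` minus its linearization is `φ r`-Lipschitz there. -/
lemma IsLocallySmoothAt.abs_sub_sub_inner_le (h : IsStandardized ν Cn) (hφ : 0 ≤ φ)
    (hs : IsLocallySmoothAt sys ν φ ρ K) {r : ℝ} (hr : 0 ≤ r) (hrρ : r ≤ ρ) {u v : Policy n m}
    (hu : ‖u‖ ≤ r) (hv : ‖v‖ ≤ r) :
    |J sys ν (K + u) - J sys ν (K + v) - inner ℝ (gradient (J sys ν) K) (u - v)| ≤
      φ * r * ‖u - v‖ := by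
  have hball : ∀ y ∈ Metric.closedBall K r, ‖y - K‖ ≤ ρ := fun y hy =>
    (mem_closedBall_iff_norm.1 hy).trans hrρ
  have := (convex_closedBall K r).norm_image_sub_le_of_norm_hasFDerivWithin_le
    (f := fun y => J sys ν y - innerSL ℝ (gradient (J sys ν) K) y)
    (f' := fun y => fderiv ℝ (J sys ν) y - innerSL ℝ (gradient (J sys ν) K)) (C := φ * r)
    (x := K + v) (y := K + u)
    (fun y hy => ((differentiableAt_J h (hs y (hball y hy)).1).hasFDerivAt.sub
      (ContinuousLinearMap.hasFDerivAt _)).hasFDerivWithinAt)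
    (fun y hy => ?_) (by simpa using hv) (by simpa using hu)
  · rw [Real.norm_eq_abs] at this
    convert this using 2
    · simp only [innerSL_apply_apply, inner_add_right, inner_sub_right]
      ring
    · congr 1; abel
  · refine ContinuousLinearMap.opNorm_le_bound _ (by positivity) fun w => ?_
    rw [sub_apply, inner_gradient_J, innerSL_apply_apply, ← inner_sub_left]
    refine (norm_inner_le_norm _ _).trans ?_
    gcongr
    refine (hs y (hball y hy)).2.trans ?_
    gcongr
    exact mem_closedBall_iff_norm.1 hy

lemma measurable_J [SFinite ν] : Measurable (J sys ν) :=
  measurable_cost.ennreal_toReal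

lemma J_nonneg (K : Policy n m) : 0 ≤ J sys ν K := ENNReal.toReal_nonneg

lemma integrable_J_mul_inner (h : IsStandardized ν Cn) (hn : 0 < n) (hm : 0 < m)
    (hL : IsLocallyLipschitzAt sys ν L ρ K) {r : ℝ} (hr : 0 ≤ r) (hrρ : r ≤ ρ) (w : Policy n m) :
    Integrable (fun u => J sys ν (K + r • u) * inner ℝ u w) (unifSphere n m) := by
  have := isProbabilityMeasure_unifSphere hn hm
  have := h.isProbabilityMeasure
  refine Integrable.of_bound (C := (J sys ν K + L * r) * ‖w‖) ?_ ?_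
  · exact ((measurable_J.comp (by fun_prop)).mul (by fun_prop)).aestronglyMeasurable
  · filter_upwards [ae_norm_unifSphere] with u hu
    have hru : ‖(K + r • u) - K‖ = r := by
      rw [add_sub_cancel_left, norm_smul, hu, mul_one, Real.norm_of_nonneg hr]
    have h1 := (hL (K + r • u) (hru.trans_le hrρ)).2
    rw [hru] at h1
    have h2 : |inner ℝ u w| ≤ ‖w‖ := by simpa [hu] using abs_real_inner_le_norm u w
    rw [norm_mul, Real.norm_of_nonneg (J_nonneg _), Real.norm_eq_abs]
    have h3 := (abs_le.1 h1).2
    have h4 := J_nonneg (sys := sys) (ν := ν) (K + r • u)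
    gcongr <;> linarith

/-- The bias of the one-point gradient estimate in the direction of the gradient. -/
lemma le_integral_J_mul_inner (h : IsStandardized ν Cn) (hn : 0 < n) (hm : 0 < m) (hφ : 0 ≤ φ)
    (hs : IsLocallySmoothAt sys ν φ ρ K) (hL : IsLocallyLipschitzAt sys ν L ρ K)
    {r : ℝ} (hr : 0 < r) (hrρ : r ≤ ρ) :
    ‖gradient (J sys ν) K‖ ^ 2 - φ * r * ‖gradient (J sys ν) K‖ ≤
      ((n * m : ℕ) : ℝ) / r *
        ∫ u, J sys ν (K + r • u) * inner ℝ u (gradient (J sys ν) K) ∂(unifSphere n m) := by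
  set g := gradient (J sys ν) K with hg
  rcases eq_or_ne g 0 with h0 | h0
  · simp [h0]
  have hgpos : 0 < ‖g‖ := norm_pos_iff.2 h0
  obtain ⟨f, hf, hf'⟩ := exists_isometry_reflection g
  have hint := integrable_J_mul_inner h hn hm hL hr.le hrρ g
  -- The reflection preserves the measure and changes the sign of `inner ℝ u g`.
  have hswap : ∫ u, J sys ν (K + r • f u) * inner ℝ u g ∂(unifSphere n m) =
      - ∫ u, J sys ν (K + r • u) * inner ℝ u g ∂(unifSphere n m) := by
    rw [← integral_unifSphere_isometry f fun u => J sys ν (K + r • u) * inner ℝ u g, ← integral_neg]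
    simp only [hf, mul_neg, neg_neg]
  have hint' : Integrable (fun u => J sys ν (K + r • f u) * inner ℝ u g) (unifSphere n m) := by
    have h1 : Integrable (fun u => J sys ν (K + r • u) * inner ℝ u g)
        ((unifSphere n m).map f) := by rwa [unifSphere_map_isometry]
    have h2 := (integrable_map_equiv f.toMeasurableEquiv _).1 h1
    refine h2.neg.congr (Filter.Eventually.of_forall fun u => ?_)
    have : inner ℝ (f.toMeasurableEquiv u) g = - inner ℝ u g := hf u
    simp only [Pi.neg_apply, Function.comp_apply, this, mul_neg, neg_neg]
    rfl
  -- Since `u - f u` is `2 ⟨u, g⟩ / ‖g‖²` times `g`, the linear part of the cost difference is `2 r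
  -- ⟨u, g⟩`, and the smoothness error is at most `φ r / ‖g‖` times its absolute value.
  have hpt : ∀ᵐ u ∂(unifSphere n m), 2 * r * (1 - φ * r / ‖g‖) * (inner ℝ u g) ^ 2 ≤
      J sys ν (K + r • u) * inner ℝ u g - J sys ν (K + r • f u) * inner ℝ u g := by
    filter_upwards [ae_norm_unifSphere] with u hu
    have h1 := hs.abs_sub_sub_inner_le h hφ hr.le hrρ (u := r • u) (v := r • f u)
      (by rw [norm_smul, hu, mul_one, Real.norm_of_nonneg hr.le])
      (by rw [norm_smul, LinearIsometryEquiv.norm_map, hu, mul_one, Real.norm_of_nonneg hr.le])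
    rw [← smul_sub, hf', ← hg, inner_smul_right, inner_smul_right, real_inner_self_eq_norm_sq,
      norm_smul, norm_smul, Real.norm_of_nonneg hr.le, Real.norm_eq_abs, abs_div, abs_mul, abs_two,
      abs_of_nonneg (sq_nonneg ‖g‖)] at h1
    set c := inner ℝ u g
    set d := J sys ν (K + r • u) - J sys ν (K + r • f u) with hd
    have h2 : r * (2 * c / ‖g‖ ^ 2 * ‖g‖ ^ 2) = 2 * r * c := by field_simp
    have h3 : φ * r * (r * (2 * |c| / ‖g‖ ^ 2 * ‖g‖)) = 2 * r * (φ * r / ‖g‖) * |c| := by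
      field_simp
    rw [h2, h3] at h1
    have h4 : |(d - 2 * r * c) * c| ≤ 2 * r * (φ * r / ‖g‖) * c ^ 2 := by
      rw [abs_mul, ← sq_abs c, sq, ← mul_assoc]
      gcongr
    have h5 := (abs_le.1 h4).1
    rw [← sub_mul, ← hd]
    linarith
  have hmono := integral_mono_ae ((integrable_sq_inner_unifSphere hn hm g).const_mul _)
    (hint.sub hint') hpt
  have hsub : ∫ u, (J sys ν (K + r • u) * inner ℝ u g - J sys ν (K + r • f u) * inner ℝ u g)
      ∂(unifSphere n m) = 2 * ∫ u, J sys ν (K + r • u) * inner ℝ u g ∂(unifSphere n m) := by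
    rw [integral_sub hint hint', hswap]
    ring
  simp only [Pi.sub_apply] at hmono
  rw [hsub, integral_const_mul] at hmono
  have hD := integral_sq_inner_unifSphere hn hm g
  set D := ((n * m : ℕ) : ℝ)
  have hD0 : 0 ≤ D / r := by positivity
  calc ‖g‖ ^ 2 - φ * r * ‖g‖ = (1 - φ * r / ‖g‖) * ‖g‖ ^ 2 := by field_simp
    _ = D / r * ((2 * r * (1 - φ * r / ‖g‖) * ∫ u, (inner ℝ u g) ^ 2 ∂(unifSphere n m)) / 2) := by
        rw [← hD]; field_simp
    _ ≤ _ := by gcongr; linarith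

end Descent

/-! ### Expected progress of one update -/

section OneStep
variable {sys : System n m} {ν : Measure (State n)} {Cn : ℝ} {K K₀ Kstar : Policy n m}
  {φ L ρ μ η r B ε : ℝ}

/-- One update of the zero-order method, with the sample `p = (x, u)`. -/
def step (sys : System n m) (η r : ℝ) (K : Policy n m) (p : State n × Policy n m) : Policy n m :=
  K - η • onePointEstimate sys r K p.2 p.1

lemma measurable_step (sys : System n m) (η r : ℝ) :
    Measurable fun q : Policy n m × State n × Policy n m => step sys η r q.1 q.2 := by
  have h1 : Measurable fun q : Policy n m × State n × Policy n m =>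
      (sampleCost sys (q.1 + r • q.2.2) q.2.1).toReal :=
    ((measurable_sampleCost_uncurry sys).comp
      (f := fun q : Policy n m × State n × Policy n m => (q.1 + r • q.2.2, q.2.1))
      (by fun_prop)).ennreal_toReal
  unfold step onePointEstimate
  exact measurable_fst.sub (((h1.mul_const _).smul (measurable_snd.comp measurable_snd)).const_smul η)

lemma IsStandardized.Cn_pos (h : IsStandardized ν Cn) (hn : 0 < n) : 0 < Cn := by
  have := h.isProbabilityMeasure
  by_contra hC
  have h1 := h.covariance ⟨0, hn⟩ ⟨0, hn⟩
  rw [if_pos rfl, integral_eq_zero_of_ae] at h1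
  · exact zero_ne_one h1
  · filter_upwards [h.bounded] with v hv
    have : v = 0 := by
      have h2 : ‖v‖ ^ 2 = 0 := le_antisymm (hv.trans (not_lt.1 hC)) (sq_nonneg _)
      simpa using h2
    simp [this]

lemma ae_prod_bounded (h : IsStandardized ν Cn) (hn : 0 < n) (hm : 0 < m) :
    ∀ᵐ p ∂(ν.prod (unifSphere n m)), ‖p.1‖ ^ 2 ≤ Cn ∧ ‖p.2‖ = 1 := by
  have := h.isProbabilityMeasure
  have := isProbabilityMeasure_unifSphere hn hm
  exact (Measure.quasiMeasurePreserving_fst.ae h.bounded).and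
    (Measure.quasiMeasurePreserving_snd.ae ae_norm_unifSphere)

lemma perturbed_bound (hL : IsLocallyLipschitzAt sys ν L ρ K) (hr : 0 < r) (hrρ : r ≤ ρ)
    (hB : J sys ν K + L * r ≤ B) {u : Policy n m} (hu : ‖u‖ = 1) :
    K + r • u ∈ finiteCost sys ν ∧ J sys ν (K + r • u) ≤ B := by
  have hru : ‖(K + r • u) - K‖ = r := by
    rw [add_sub_cancel_left, norm_smul, hu, mul_one, Real.norm_of_nonneg hr.le]
  obtain ⟨h1, h2⟩ := hL (K + r • u) (hru.trans_le hrρ)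
  rw [hru] at h2
  exact ⟨h1, by linarith [(abs_le.1 h2).2]⟩

lemma toReal_sampleCost_le (h : IsStandardized ν Cn) (hK : K ∈ finiteCost sys ν) {x : State n}
    (hx : ‖x‖ ^ 2 ≤ Cn) : (sampleCost sys K x).toReal ≤ Cn * J sys ν K := by
  have h1 := ENNReal.toReal_mono (ENNReal.mul_ne_top ENNReal.ofReal_ne_top hK) (sampleCost_le h K x)
  rw [ENNReal.toReal_mul, ENNReal.toReal_ofReal (sq_nonneg _)] at h1
  exact h1.trans (mul_le_mul_of_nonneg_right hx (J_nonneg K))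

/-- A rollout at the perturbed policy costs at most `Cn * B`, so almost every update has length at
most `ρ` and the descent inequality applies to each sample, not only on average. -/
lemma ae_step (h : IsStandardized ν Cn) (hn : 0 < n) (hm : 0 < m) (hφ : 0 ≤ φ)
    (hs : IsLocallySmoothAt sys ν φ ρ K) (hL : IsLocallyLipschitzAt sys ν L ρ K)
    (hr : 0 < r) (hrρ : r ≤ ρ) (hη : 0 < η) (hB : J sys ν K + L * r ≤ B)
    (hstep : η * (((n * m : ℕ) : ℝ) / r * (Cn * B)) ≤ ρ) :
    ∀ᵐ p ∂(ν.prod (unifSphere n m)), step sys η r K p ∈ finiteCost sys ν ∧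
      (sampleCost sys (K + r • p.2) p.1).toReal ≤ Cn * B ∧
      J sys ν (step sys η r K p) ≤ J sys ν K - η * (((n * m : ℕ) : ℝ) / r *
        ((sampleCost sys (K + r • p.2) p.1).toReal * inner ℝ p.2 (gradient (J sys ν) K))) +
        φ / 2 * (η * (((n * m : ℕ) : ℝ) / r * (Cn * B))) ^ 2 := by
  filter_upwards [ae_prod_bounded h hn hm] with p hp
  obtain ⟨hx, hu⟩ := hp
  obtain ⟨hfin, hJ⟩ := perturbed_bound hL hr hrρ hB hu
  have hC := h.Cn_pos hn
  have hsc : (sampleCost sys (K + r • p.2) p.1).toReal ≤ Cn * B :=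
    (toReal_sampleCost_le h hfin hx).trans (mul_le_mul_of_nonneg_left hJ hC.le)
  have hsc0 : 0 ≤ (sampleCost sys (K + r • p.2) p.1).toReal := ENNReal.toReal_nonneg
  set s := (sampleCost sys (K + r • p.2) p.1).toReal with hsdef
  set D := ((n * m : ℕ) : ℝ) with hD
  have hD0 : 0 ≤ D / r := by positivity
  set v : Policy n m := (-(η * (s * (D / r)))) • p.2 with hv
  have hstepeq : step sys η r K p = K + v := by
    rw [step, onePointEstimate, ← hsdef, ← hD, hv, smul_smul, neg_smul, sub_eq_add_neg]
  have hvn : ‖v‖ ≤ η * (D / r * (Cn * B)) := by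
    rw [hv, norm_smul, hu, mul_one, norm_neg, Real.norm_of_nonneg (by positivity), mul_comm s]
    gcongr
  rw [hstepeq]
  refine ⟨(hs (K + v) (by simpa using hvn.trans hstep)).1, hsc, ?_⟩
  refine (hs.descent h (hvn.trans hstep)).trans ?_
  have h1 : inner ℝ (gradient (J sys ν) K) v =
      -(η * (D / r * (s * inner ℝ p.2 (gradient (J sys ν) K)))) := by
    rw [hv, inner_smul_right, real_inner_comm]
    ring
  rw [h1, sub_eq_add_neg]
  gcongr

/-- By Fubini, averaging over the initial state first replaces the rollout by the population cost.
-/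
lemma integral_sampleCost_mul_inner (h : IsStandardized ν Cn) (hn : 0 < n) (hm : 0 < m)
    (hL : IsLocallyLipschitzAt sys ν L ρ K) (hr : 0 < r) (hrρ : r ≤ ρ) (w : Policy n m) :
    Integrable (fun p : State n × Policy n m =>
      (sampleCost sys (K + r • p.2) p.1).toReal * inner ℝ p.2 w) (ν.prod (unifSphere n m)) ∧
    ∫ p, (sampleCost sys (K + r • p.2) p.1).toReal * inner ℝ p.2 w ∂(ν.prod (unifSphere n m)) =
      ∫ u, J sys ν (K + r • u) * inner ℝ u w ∂(unifSphere n m) := by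
  have := h.isProbabilityMeasure
  have := isProbabilityMeasure_unifSphere hn hm
  have hmeas : Measurable fun p : State n × Policy n m => sampleCost sys (K + r • p.2) p.1 :=
    (measurable_sampleCost_uncurry sys).comp
      (f := fun p : State n × Policy n m => (K + r • p.2, p.1)) (by fun_prop)
  have hC := h.Cn_pos hn
  have hint : Integrable (fun p : State n × Policy n m =>
      (sampleCost sys (K + r • p.2) p.1).toReal * inner ℝ p.2 w) (ν.prod (unifSphere n m)) := by
    refine Integrable.of_bound (C := Cn * (J sys ν K + L * r) * ‖w‖) ?_ ?_
    · exact (hmeas.ennreal_toReal.mul (by fun_prop)).aestronglyMeasurable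
    · filter_upwards [ae_prod_bounded h hn hm] with p hp
      obtain ⟨hfin, hJ⟩ := perturbed_bound hL hr hrρ le_rfl hp.2
      have h2 : |inner ℝ p.2 w| ≤ ‖w‖ := by simpa [hp.2] using abs_real_inner_le_norm p.2 w
      have h3 := toReal_sampleCost_le h hfin hp.1
      have h4 := J_nonneg (sys := sys) (ν := ν) (K + r • p.2)
      rw [norm_mul, Real.norm_of_nonneg ENNReal.toReal_nonneg, Real.norm_eq_abs]
      have h5 : (sampleCost sys (K + r • p.2) p.1).toReal ≤ Cn * (J sys ν K + L * r) :=
        h3.trans (by gcongr)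
      exact mul_le_mul h5 h2 (abs_nonneg _) (mul_nonneg hC.le (h4.trans hJ))
  refine ⟨hint, ?_⟩
  rw [integral_prod_symm _ hint]
  refine integral_congr_ae ?_
  filter_upwards [ae_norm_unifSphere] with u hu
  have hfin := (perturbed_bound hL hr hrρ le_rfl hu).1
  rw [integral_mul_const, integral_toReal]
  · rfl
  · exact (hmeas.comp measurable_prodMk_right).aemeasurable
  · exact Filter.Eventually.of_forall fun x => (sampleCost_ne_top h hfin x).lt_top

/-- The expected cost after one update. -/
lemma integral_J_step_le (h : IsStandardized ν Cn) (hn : 0 < n) (hm : 0 < m) (hφ : 0 ≤ φ)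
    (hs : IsLocallySmoothAt sys ν φ ρ K) (hL : IsLocallyLipschitzAt sys ν L ρ K)
    (hr : 0 < r) (hrρ : r ≤ ρ) (hη : 0 < η) (hB : J sys ν K + L * r ≤ B)
    (hstep : η * (((n * m : ℕ) : ℝ) / r * (Cn * B)) ≤ ρ) :
    Integrable (fun p => J sys ν (step sys η r K p)) (ν.prod (unifSphere n m)) ∧
    ∫ p, J sys ν (step sys η r K p) ∂(ν.prod (unifSphere n m)) ≤
      J sys ν K - η * (‖gradient (J sys ν) K‖ ^ 2 - φ * r * ‖gradient (J sys ν) K‖) +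
        φ / 2 * (η * (((n * m : ℕ) : ℝ) / r * (Cn * B))) ^ 2 := by
  have := h.isProbabilityMeasure
  have := isProbabilityMeasure_unifSphere hn hm
  have hae := ae_step h hn hm hφ hs hL hr hrρ hη hB hstep
  obtain ⟨hint, heq⟩ := integral_sampleCost_mul_inner h hn hm hL hr hrρ (gradient (J sys ν) K)
  have hbias := le_integral_J_mul_inner h hn hm hφ hs hL hr hrρ
  set D := ((n * m : ℕ) : ℝ) with hD
  set M := φ / 2 * (η * (D / r * (Cn * B))) ^ 2 with hM
  have hlin : Integrable (fun p : State n × Policy n m => η * (D / r *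
      ((sampleCost sys (K + r • p.2) p.1).toReal * inner ℝ p.2 (gradient (J sys ν) K))))
      (ν.prod (unifSphere n m)) := (hint.const_mul _).const_mul _
  have hdiff : Integrable (fun p : State n × Policy n m => J sys ν K - η * (D / r *
      ((sampleCost sys (K + r • p.2) p.1).toReal * inner ℝ p.2 (gradient (J sys ν) K))))
      (ν.prod (unifSphere n m)) := (integrable_const _).sub hlin
  have hub : Integrable (fun p : State n × Policy n m => J sys ν K - η * (D / r *
      ((sampleCost sys (K + r • p.2) p.1).toReal * inner ℝ p.2 (gradient (J sys ν) K))) + M)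
      (ν.prod (unifSphere n m)) :=
    hdiff.add (integrable_const _)
  have hmeas : Measurable fun p => J sys ν (step sys η r K p) :=
    measurable_J.comp ((measurable_step sys η r).comp measurable_prodMk_left)
  have hintJ : Integrable (fun p => J sys ν (step sys η r K p)) (ν.prod (unifSphere n m)) := by
    refine hub.mono' hmeas.aestronglyMeasurable ?_
    filter_upwards [hae] with p hp
    rw [Real.norm_of_nonneg (J_nonneg _)]
    exact hp.2.2
  refine ⟨hintJ, ?_⟩
  refine (integral_mono_ae hintJ hub (hae.mono fun p hp => hp.2.2)).trans ?_
  rw [integral_add hdiff (integrable_const _), integral_sub (integrable_const _) hlin, integral_const_mul,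
    integral_const_mul, heq, integral_const, integral_const, probReal_univ, one_smul, one_smul]
  gcongr

/-- The constants of the step-size and radius conditions give a contraction in expectation. -/
lemma contraction (h : IsStandardized ν Cn) (hn : 0 < n) (hm : 0 < m)
    (hK₀ : K₀ ∈ finiteCost sys ν)
    (hb : CurvatureBounds sys ν K₀ Kstar φ L ρ μ) (hε : 0 < ε) (hη : 0 < η) (hr : 0 < r)
    (hstep : StepSizeCondition (1 / 48000) ((n * m : ℕ) : ℝ) Cn (J sys ν K₀) φ ρ μ ε r η)
    (hrad : RadiusCondition (J sys ν K₀) φ L ρ μ ε r)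
    (hK : K ∈ boundedSet sys ν K₀ Kstar) :
    (∀ᵐ p ∂(ν.prod (unifSphere n m)), step sys η r K p ∈ finiteCost sys ν) ∧
    Integrable (fun p => J sys ν (step sys η r K p)) (ν.prod (unifSphere n m)) ∧
    ∫ p, J sys ν (step sys η r K p) ∂(ν.prod (unifSphere n m)) - J sys ν Kstar ≤
      (1 - η * μ / 2) * (J sys ν K - J sys ν Kstar) + η * μ * ε / 120 := by
  have hφ := hb.φ_pos
  have hLp := hb.L_pos
  have hρ := hb.ρ_pos
  have hμ := hb.μ_pos
  have hC := h.Cn_pos hn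
  have hc₀ := J_pos h hn hK₀
  have hstar0 := J_nonneg (sys := sys) (ν := ν) Kstar
  have hpl := hb.pl K hK.1
  have hbd := hK.2
  rw [initGap] at hbd
  set c₀ := J sys ν K₀ with hc₀def
  have hD : (0 : ℝ) < ((n * m : ℕ) : ℝ) := by exact_mod_cast Nat.mul_pos hn hm
  rw [RadiusCondition, le_min_iff, le_min_iff, le_min_iff] at hrad
  obtain ⟨-, hr1, hrρ, hrL⟩ := hrad
  rw [le_div_iff₀ hLp] at hrL
  have hC48 : (0 : ℝ) < 1 / 48000 := by norm_num
  rw [StepSizeCondition, mul_min_of_nonneg _ _ hC48.le, mul_min_of_nonneg _ _ hC48.le,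
    le_min_iff, le_min_iff] at hstep
  obtain ⟨hη1, -, hη2⟩ := hstep
  set D := ((n * m : ℕ) : ℝ) with hDdef
  -- In the bounded set the cost is at most `10 c₀`, and the radius condition gives `L r ≤ 10 c₀`.
  set B := 20 * c₀ with hB
  have hJB : J sys ν K + L * r ≤ B := by linarith
  have hstepρ : η * (D / r * (Cn * B)) ≤ ρ := by
    calc η * (D / r * (Cn * B)) ≤ 1 / 48000 * (ρ * r / (Cn * D * c₀)) * (D / r * (Cn * B)) := by
          gcongr
      _ = 20 / 48000 * ρ := by rw [hB]; field_simp
      _ ≤ ρ := by linarith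
  -- The factor `20² / 2 = 200` from `B` and the target `1/240` give the constant `1/48000 = 1/(200
  -- · 240)`.
  have hvar : φ / 2 * (η * (D / r * (Cn * B))) ^ 2 ≤ η * (μ * ε / 240) := by
    calc φ / 2 * (η * (D / r * (Cn * B))) ^ 2 = η * (η * (φ / 2 * (D / r * (Cn * B)) ^ 2)) := by ring
      _ ≤ η * (1 / 48000 * (ε * μ * r ^ 2 / (φ * Cn ^ 2 * D ^ 2 * c₀ ^ 2)) *
          (φ / 2 * (D / r * (Cn * B)) ^ 2)) := by gcongr
      _ = η * (μ * ε / 240) := by rw [hB]; field_simp; norm_num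
  have hbias : (φ * r) ^ 2 ≤ ε * μ / 120 := by
    have h1 : φ * r ≤ √(ε * μ / 30) / 2 := by
      calc φ * r ≤ φ * (1 / (2 * φ) * √(ε * μ / 30)) := by gcongr
        _ = _ := by field_simp
    calc (φ * r) ^ 2 ≤ (√(ε * μ / 30) / 2) ^ 2 := by gcongr
      _ = ε * μ / 120 := by rw [div_pow, Real.sq_sqrt (by positivity)]; ring
  have hs := hb.smooth K hK
  have hL := hb.lipschitz K hK
  obtain ⟨hint, hle⟩ := integral_J_step_le h hn hm hφ.le hs hL hr hrρ hη hJB hstepρ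
  refine ⟨(ae_step h hn hm hφ.le hs hL hr hrρ hη hJB hstepρ).mono fun p hp => hp.1, hint, ?_⟩
  set G := ‖gradient (J sys ν) K‖ with hG
  -- Half of the squared gradient absorbs the bias. The remaining `εμ/240` and the variance term add
  -- up to `εμ/120`.
  have hyoung : G ^ 2 / 2 - ε * μ / 240 ≤ G ^ 2 - φ * r * G := by
    nlinarith [sq_nonneg (G - φ * r)]
  have h1 : η * (μ * (J sys ν K - J sys ν Kstar) / 2 - ε * μ / 240) ≤
      η * (G ^ 2 - φ * r * G) := by
    refine mul_le_mul_of_nonneg_left ?_ hη.le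
    linarith
  linarith

end OneStep

/-! ### The PL constant is at most twice the smoothness constant -/

section Conditioning
variable {sys : System n m} {ν : Measure (State n)} {Cn : ℝ} {K K₀ Kstar : Policy n m}
  {φ L ρ μ : ℝ}

/-- Policies of arbitrarily small positive gap exist, because the set of minimizers is compact and
the policy space is connected. -/
lemma exists_small_gap (h : IsStandardized ν Cn) (hK₀ : K₀ ∈ finiteCost sys ν)
    (hopt : IsOptimal sys ν Kstar) (hgap : 0 < initGap sys ν K₀ Kstar) {δ : ℝ} (hδ : 0 < δ) :
    ∃ K ∈ finiteCost sys ν, 0 < J sys ν K - J sys ν Kstar ∧ J sys ν K - J sys ν Kstar < δ := by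
  by_contra! hno
  have hstar := hopt.mem_finiteCost hK₀
  have hclosed : IsClosed {K | cost sys ν K ≤ cost sys ν Kstar} :=
    (isCompact_sublevel h sys hstar).isClosed
  -- With no gaps strictly between `0` and `δ`, being optimal is the open condition of having gap
  -- below `δ`.
  have heq : {K | cost sys ν K ≤ cost sys ν Kstar} =
      finiteCost sys ν ∩ J sys ν ⁻¹' Set.Iio (J sys ν Kstar + δ) := by
    ext K
    constructor
    · intro hK
      have h1 : J sys ν K ≤ J sys ν Kstar := ENNReal.toReal_mono hstar hK
      exact ⟨ne_top_of_le_ne_top hstar hK, by simp only [Set.mem_preimage, Set.mem_Iio]; linarith⟩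
    · rintro ⟨hK, hK'⟩
      simp only [Set.mem_preimage, Set.mem_Iio] at hK'
      have h1 : J sys ν K ≤ J sys ν Kstar := by
        by_contra h2
        have := hno K hK (by linarith)
        linarith
      exact (ENNReal.toReal_le_toReal hK hstar).1 h1
  have hopen : IsOpen {K | cost sys ν K ≤ cost sys ν Kstar} := by
    rw [heq]
    exact (contDiffOn_J h).continuousOn.isOpen_inter_preimage (isOpen_finiteCost h) isOpen_Iio
  have huniv := IsClopen.eq_univ ⟨hclosed, hopen⟩ ⟨Kstar, le_refl (cost sys ν Kstar)⟩
  have hmem : K₀ ∈ {K | cost sys ν K ≤ cost sys ν Kstar} := huniv ▸ Set.mem_univ K₀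
  have : J sys ν K₀ ≤ J sys ν Kstar := ENNReal.toReal_mono hstar hmem
  rw [initGap] at hgap
  linarith

/-- At a policy of small positive gap, a gradient step of size `1/φ` shows `‖g‖² ≤ 2 φ · gap`, while
the PL inequality gives `μ · gap ≤ ‖g‖²`. The bound keeps `1 - ημ/2` nonnegative later. -/
lemma CurvatureBounds.μ_le (hb : CurvatureBounds sys ν K₀ Kstar φ L ρ μ)
    (h : IsStandardized ν Cn) (hK₀ : K₀ ∈ finiteCost sys ν)
    (hopt : IsOptimal sys ν Kstar) (hgap : 0 < initGap sys ν K₀ Kstar) : μ ≤ 2 * φ := by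
  have hφ := hb.φ_pos
  have hρ := hb.ρ_pos
  obtain ⟨K, hK, hpos, hlt⟩ := exists_small_gap h hK₀ hopt hgap
    (lt_min (by positivity : 0 < φ * ρ ^ 2 / 2) (by positivity : 0 < 10 * initGap sys ν K₀ Kstar))
  rw [lt_min_iff] at hlt
  have hs := hb.smooth K ⟨hK, hlt.2.le⟩
  have hpl := hb.pl K hK
  set g := gradient (J sys ν) K with hg
  have hdesc : ∀ c : ℝ, 0 ≤ c → c * ‖g‖ ≤ ρ →
      c * ‖g‖ ^ 2 - φ / 2 * (c * ‖g‖) ^ 2 ≤ J sys ν K - J sys ν Kstar := by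
    intro c hc hcρ
    have hv : ‖(-c) • g‖ = c * ‖g‖ := by rw [norm_smul, norm_neg, Real.norm_of_nonneg hc]
    have h1 := hs.descent h (v := (-c) • g) (hv.trans_le hcρ)
    have h2 := hopt.J_le (hs (K + (-c) • g) (by rwa [add_sub_cancel_left, hv])).1
    rw [hv, ← hg, inner_smul_right, real_inner_self_eq_norm_sq] at h1
    linarith
  rcases le_or_gt ‖g‖ (φ * ρ) with hsmall | hbig
  · have h1 := hdesc φ⁻¹ (by positivity) (by rw [inv_mul_le_iff₀ hφ]; exact hsmall)
    have h2 : φ⁻¹ * ‖g‖ ^ 2 - φ / 2 * (φ⁻¹ * ‖g‖) ^ 2 = ‖g‖ ^ 2 / (2 * φ) := by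
      field_simp; norm_num
    rw [h2, div_le_iff₀ (by positivity)] at h1
    nlinarith
  -- If the step `g/φ` is longer than `ρ`, a step of length `ρ` already decreases the cost by more
  -- than `φ ρ² / 2`, against the choice of the gap.
  · have hgpos : 0 < ‖g‖ := lt_trans (by positivity) hbig
    have h1 := hdesc (ρ / ‖g‖) (by positivity) (by rw [div_mul_cancel₀ _ hgpos.ne'])
    have h2 : ρ / ‖g‖ * ‖g‖ ^ 2 = ρ * ‖g‖ := by field_simp
    rw [h2, div_mul_cancel₀ _ hgpos.ne'] at h1
    nlinarith [hlt.1]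

end Conditioning

/-! ### Drift under one transition -/

section MarkovChain
variable {X Y : Type*} [MeasurableSpace X] [MeasurableSpace Y]

lemma integral_map_prod_le {m : Measure X} {κ : Measure Y} [IsProbabilityMeasure m]
    [IsProbabilityMeasure κ] {F : X × Y → X} (hF : Measurable F) {V : X → ℝ} (hV : Measurable V)
    {c : ℝ} (hc : ∀ K, |V K| ≤ c) {α b : ℝ}
    (hle : ∀ K, ∫ p, V (F (K, p)) ∂κ ≤ α * V K + b) :
    ∫ K, V K ∂((m.prod κ).map F) ≤ α * ∫ K, V K ∂m + b := by
  have hint : Integrable (fun z => V (F z)) (m.prod κ) :=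
    Integrable.of_bound (C := c) (hV.comp hF).aestronglyMeasurable
      (Filter.Eventually.of_forall fun z => hc _)
  have hintV : Integrable V m :=
    Integrable.of_bound (C := c) hV.aestronglyMeasurable (Filter.Eventually.of_forall fun z => hc _)
  rw [integral_map hF.aemeasurable hV.aestronglyMeasurable, integral_prod _ hint]
  calc _ ≤ ∫ K, (α * V K + b) ∂m :=
        integral_mono hint.integral_prod_left ((hintV.const_mul α).add (integrable_const b)) hle
    _ = _ := by
        rw [integral_add (hintV.const_mul α) (integrable_const b), integral_const_mul]
        simp

end MarkovChain

/-! ### Processes driven by independent samples -/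

section DrivenProcess
variable {Ω : Type*} [MeasurableSpace Ω] {P : Measure Ω} {ν : Measure (State n)}
  {x : ℕ → Ω → State n} {u : ℕ → Ω → Policy n m}

/-- A process driven by `F` and the samples `(x t, u t)`. -/
def drivenProcess (F : Policy n m × State n × Policy n m → Policy n m) (K₀ : Policy n m)
    (x : ℕ → State n) (u : ℕ → Policy n m) : ℕ → Policy n m
  | 0 => K₀
  | t + 1 => F (drivenProcess F K₀ x u t, x t, u t)

/-- The state at time `t` uses only the samples before `t`, hence is independent of sample `t`. -/
lemma exists_measurable_drivenProcess {F : Policy n m × State n × Policy n m → Policy n m}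
    (hF : Measurable F) (K₀ : Policy n m) (t : ℕ) :
    ∃ f : ((i : Finset.range t) → State n × Policy n m) → Policy n m, Measurable f ∧
      ∀ (x : ℕ → State n) (u : ℕ → Policy n m),
        drivenProcess F K₀ x u t = f fun i => (x i, u i) := by
  induction t with
  | zero => exact ⟨fun _ => K₀, measurable_const, fun x u => rfl⟩
  | succ t ih =>
    obtain ⟨f, hf, hfx⟩ := ih
    refine ⟨fun z => F (f fun i => z ⟨i, Finset.mem_range.2
      ((Finset.mem_range.1 i.2).trans t.lt_succ_self)⟩,
      z ⟨t, Finset.mem_range.2 t.lt_succ_self⟩), ?_, fun x u => ?_⟩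
    · refine hF.comp (Measurable.prodMk (hf.comp ?_) (measurable_pi_apply _))
      exact measurable_pi_lambda _ fun i => measurable_pi_apply _
    · rw [drivenProcess, hfx]

lemma IsSampling.measurable_sample (hs : IsSampling P ν x u) (t : ℕ) :
    Measurable fun ω => (x t ω, u t ω) :=
  (hs.measurable_state t).prodMk (hs.measurable_direction t)

lemma IsSampling.measurable_drivenProcess (hs : IsSampling P ν x u)
    {F : Policy n m × State n × Policy n m → Policy n m} (hF : Measurable F) (K₀ : Policy n m)
    (t : ℕ) : Measurable fun ω => drivenProcess F K₀ (fun s => x s ω) (fun s => u s ω) t := by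
  obtain ⟨f, hf, hfx⟩ := exists_measurable_drivenProcess hF K₀ t
  simp only [hfx]
  exact hf.comp (measurable_pi_lambda _ fun i => hs.measurable_sample i)

lemma IsSampling.map_drivenProcess_succ [IsProbabilityMeasure P] (hs : IsSampling P ν x u)
    {F : Policy n m × State n × Policy n m → Policy n m} (hF : Measurable F) (K₀ : Policy n m)
    (t : ℕ) :
    P.map (fun ω => drivenProcess F K₀ (fun s => x s ω) (fun s => u s ω) (t + 1)) =
      ((P.map fun ω => drivenProcess F K₀ (fun s => x s ω) (fun s => u s ω) t).prod
        (ν.prod (unifSphere n m))).map F := by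
  obtain ⟨f, hf, hfx⟩ := exists_measurable_drivenProcess hF K₀ t
  have hmeas := hs.measurable_drivenProcess hF K₀ t
  have hindep : IndepFun (fun ω => drivenProcess F K₀ (fun s => x s ω) (fun s => u s ω) t)
      (fun ω => (x t ω, u t ω)) P := by
    have h1 := hs.indep.indepFun_finset (Finset.range t) {t} (by simp) hs.measurable_sample
    have hψ : Measurable fun z : (({t} : Finset ℕ) → State n × Policy n m) =>
      z ⟨t, Finset.mem_singleton_self t⟩ := measurable_pi_apply _
    have h2 := h1.comp hf hψ
    simp only [hfx]
    exact h2
  rw [← hs.law t, ← (indepFun_iff_map_prod_eq_prod_map_map hmeas.aemeasurable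
    (hs.measurable_sample t).aemeasurable).1 hindep,
    Measure.map_map hF (hmeas.prodMk (hs.measurable_sample t))]
  rfl

/-- A drift condition for a bounded function propagates along the process. -/
lemma IsSampling.integral_drivenProcess_le [IsProbabilityMeasure P] (hs : IsSampling P ν x u)
    {F : Policy n m × State n × Policy n m → Policy n m} (hF : Measurable F) (K₀ : Policy n m)
    {V : Policy n m → ℝ} (hV : Measurable V)
    {c : ℝ} (hc : ∀ K, |V K| ≤ c) {α b : ℝ}
    (hle : ∀ K, ∫ p, V (F (K, p)) ∂(ν.prod (unifSphere n m)) ≤ α * V K + b) (t : ℕ) :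
    ∫ ω, V (drivenProcess F K₀ (fun s => x s ω) (fun s => u s ω) (t + 1)) ∂P ≤
      α * ∫ ω, V (drivenProcess F K₀ (fun s => x s ω) (fun s => u s ω) t) ∂P + b := by
  have hm := hs.measurable_drivenProcess hF K₀
  have : IsProbabilityMeasure (ν.prod (unifSphere n m)) := by
    rw [← hs.law 0]
    exact Measure.isProbabilityMeasure_map (hs.measurable_sample 0).aemeasurable
  have := Measure.isProbabilityMeasure_map (μ := P) (hm t).aemeasurable
  rw [← integral_map (hm (t + 1)).aemeasurable hV.aestronglyMeasurable (f := V),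
    ← integral_map (hm t).aemeasurable hV.aestronglyMeasurable (f := V),
    hs.map_drivenProcess_succ hF]
  exact integral_map_prod_le hF hV hc hle

end DrivenProcess

/-! ### The stopped process and its success probability -/

section Convergence
variable {sys : System n m} {ν : Measure (State n)} {Cn : ℝ} {K K₀ Kstar : Policy n m}
  {φ L ρ μ η r ε : ℝ}

open Classical in
/-- The update of the zero-order method, stopped outside the bounded set. -/
def stoppedStep (sys : System n m) (ν : Measure (State n)) (K₀ Kstar : Policy n m) (η r : ℝ)
    (q : Policy n m × State n × Policy n m) : Policy n m :=
  if q.1 ∈ boundedSet sys ν K₀ Kstar then step sys η r q.1 q.2 else q.1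

open Classical in
/-- The gap on the bounded set, and `c` outside of it. -/
def cappedGap (sys : System n m) (ν : Measure (State n)) (K₀ Kstar : Policy n m) (c : ℝ)
    (K : Policy n m) : ℝ :=
  if K ∈ boundedSet sys ν K₀ Kstar then J sys ν K - J sys ν Kstar else c

lemma measurable_stoppedStep (h : IsStandardized ν Cn) :
    Measurable (stoppedStep sys ν K₀ Kstar η r) := by
  refine Measurable.ite ?_ (measurable_step sys η r) measurable_fst
  exact measurable_fst (isCompact_boundedSet h).measurableSet

lemma measurable_cappedGap (h : IsStandardized ν Cn) (c : ℝ) :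
    Measurable (cappedGap sys ν K₀ Kstar c) := by
  have := h.isProbabilityMeasure
  exact Measurable.ite (isCompact_boundedSet h).measurableSet
    (measurable_J.sub measurable_const) measurable_const

lemma cappedGap_nonneg (hopt : IsOptimal sys ν Kstar) {c : ℝ} (hc : 0 ≤ c) (K : Policy n m) :
    0 ≤ cappedGap sys ν K₀ Kstar c K := by
  unfold cappedGap
  split_ifs with hK
  · exact sub_nonneg.2 (hopt.J_le hK.1)
  · exact hc

lemma abs_cappedGap_le (hopt : IsOptimal sys ν Kstar) {c : ℝ} (hc : 0 ≤ c)
    (hc' : c ≤ 10 * initGap sys ν K₀ Kstar) (K : Policy n m) :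
    |cappedGap sys ν K₀ Kstar c K| ≤ 10 * initGap sys ν K₀ Kstar := by
  rw [abs_of_nonneg (cappedGap_nonneg hopt hc K)]
  unfold cappedGap
  split_ifs with hK
  · exact hK.2
  · exact hc'

/-- Outside the bounded set the true gap exceeds `10 Δ₀ ≥ c`, so capping can only lower it; both
caps `0` and `10 Δ₀` thus inherit the drift of the true gap. -/
lemma cappedGap_le_gap {c : ℝ} (hc' : c ≤ 10 * initGap sys ν K₀ Kstar)
    (hK : K ∈ finiteCost sys ν) :
    cappedGap sys ν K₀ Kstar c K ≤ J sys ν K - J sys ν Kstar := by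
  unfold cappedGap
  split_ifs with hK'
  · exact le_rfl
  · refine hc'.trans (le_of_lt ?_)
    by_contra hlt
    exact hK' ⟨hK, not_lt.1 hlt⟩

/-- The hypotheses of the convergence theorem. -/
structure Admissible (sys : System n m) (ν : Measure (State n)) (Cn : ℝ) (K₀ Kstar : Policy n m)
    (φ L ρ μ ε η r : ℝ) : Prop where
  n_pos : 0 < n
  m_pos : 0 < m
  standardized : IsStandardized ν Cn
  mem_finiteCost : K₀ ∈ finiteCost sys ν
  optimal : IsOptimal sys ν Kstar
  curvature : CurvatureBounds sys ν K₀ Kstar φ L ρ μ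
  ε_pos : 0 < ε
  η_pos : 0 < η
  r_pos : 0 < r
  step_size : StepSizeCondition (1 / 48000) ((n * m : ℕ) : ℝ) Cn (J sys ν K₀) φ ρ μ ε r η
  radius : RadiusCondition (J sys ν K₀) φ L ρ μ ε r

lemma Admissible.drift_of_mem (ha : Admissible sys ν Cn K₀ Kstar φ L ρ μ ε η r)
    (hK : K ∈ boundedSet sys ν K₀ Kstar) {c : ℝ} (hc : 0 ≤ c)
    (hc' : c ≤ 10 * initGap sys ν K₀ Kstar) :
    ∫ p, cappedGap sys ν K₀ Kstar c (stoppedStep sys ν K₀ Kstar η r (K, p))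
        ∂(ν.prod (unifSphere n m)) ≤
      (1 - η * μ / 2) * cappedGap sys ν K₀ Kstar c K + η * μ * ε / 120 := by
  have h := ha.standardized
  have := h.isProbabilityMeasure
  have := isProbabilityMeasure_unifSphere ha.n_pos ha.m_pos
  obtain ⟨hfin, hint, hle⟩ := contraction h ha.n_pos ha.m_pos ha.mem_finiteCost ha.curvature
    ha.ε_pos ha.η_pos ha.r_pos ha.step_size ha.radius hK
  have h1 : cappedGap sys ν K₀ Kstar c K = J sys ν K - J sys ν Kstar := if_pos hK
  have h2 : ∀ p, stoppedStep sys ν K₀ Kstar η r (K, p) = step sys η r K p := fun p => if_pos hK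
  simp only [h1, h2]
  refine le_trans ?_ hle
  have hsub : ∫ p, J sys ν (step sys η r K p) ∂(ν.prod (unifSphere n m)) - J sys ν Kstar =
      ∫ p, (J sys ν (step sys η r K p) - J sys ν Kstar) ∂(ν.prod (unifSphere n m)) := by
    rw [integral_sub hint (integrable_const _)]
    simp
  rw [hsub]
  refine integral_mono_ae ?_ (hint.sub (integrable_const _)) ?_
  · refine Integrable.of_bound (C := 10 * initGap sys ν K₀ Kstar) ?_
      (Filter.Eventually.of_forall fun p => abs_cappedGap_le ha.optimal hc hc' _)
    exact ((measurable_cappedGap h c).comp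
      ((measurable_step sys η r).comp measurable_prodMk_left)).aestronglyMeasurable
  · exact hfin.mono fun p hp => cappedGap_le_gap hc' hp

lemma drift_of_notMem [IsProbabilityMeasure (ν.prod (unifSphere n m))]
    (hK : K ∉ boundedSet sys ν K₀ Kstar) (c : ℝ) :
    ∫ p, cappedGap sys ν K₀ Kstar c (stoppedStep sys ν K₀ Kstar η r (K, p))
        ∂(ν.prod (unifSphere n m)) = c := by
  have h1 : ∀ p, cappedGap sys ν K₀ Kstar c (stoppedStep sys ν K₀ Kstar η r (K, p)) = c := by
    intro p
    have h2 : stoppedStep sys ν K₀ Kstar η r (K, p) = K := if_neg hK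
    rw [h2]
    exact if_neg hK
  simp [h1]

variable {Ω : Type*} [MeasurableSpace Ω] {P : Measure Ω}
  {x : ℕ → Ω → State n} {u : ℕ → Ω → Policy n m}

/-- The iterates stopped at their exit from the bounded set. -/
abbrev stoppedIterate (sys : System n m) (ν : Measure (State n)) (K₀ Kstar : Policy n m) (η r : ℝ)
    (x : ℕ → State n) (u : ℕ → Policy n m) (t : ℕ) : Policy n m :=
  drivenProcess (stoppedStep sys ν K₀ Kstar η r) K₀ x u t

/-- The expected gap, with the value `10 Δ₀` outside of the bounded set, grows at most linearly. -/
lemma Admissible.integral_cappedGap_exit_le [IsProbabilityMeasure P]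
    (ha : Admissible sys ν Cn K₀ Kstar φ L ρ μ ε η r) (hs : IsSampling P ν x u) (t : ℕ) :
    ∫ ω, cappedGap sys ν K₀ Kstar (10 * initGap sys ν K₀ Kstar) (stoppedIterate sys ν K₀ Kstar η r
        (fun s => x s ω) (fun s => u s ω) t) ∂P ≤
      initGap sys ν K₀ Kstar + η * μ * ε / 120 * t := by
  have h := ha.standardized
  have := h.isProbabilityMeasure
  have := isProbabilityMeasure_unifSphere ha.n_pos ha.m_pos
  have hgap := initGap_nonneg ha.optimal ha.mem_finiteCost
  have hμ := ha.curvature.μ_pos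
  have hη := ha.η_pos
  have hε := ha.ε_pos
  induction t with
  | zero =>
    have h0 : cappedGap sys ν K₀ Kstar (10 * initGap sys ν K₀ Kstar) K₀ = initGap sys ν K₀ Kstar :=
      if_pos (mem_boundedSet_self ha.optimal ha.mem_finiteCost)
    simp [drivenProcess, h0]
  | succ t ih =>
    have h1 := hs.integral_drivenProcess_le
      (measurable_stoppedStep (sys := sys) (K₀ := K₀) (Kstar := Kstar) (η := η) (r := r) h) K₀
      (measurable_cappedGap (sys := sys) (K₀ := K₀) (Kstar := Kstar) h (10 * initGap sys ν K₀ Kstar))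
      (abs_cappedGap_le ha.optimal (by positivity) le_rfl)
      (α := 1) (b := η * μ * ε / 120) (fun K => ?_) t
    · push_cast
      linarith
    · by_cases hK : K ∈ boundedSet sys ν K₀ Kstar
      · refine (ha.drift_of_mem hK (by positivity) le_rfl).trans ?_
        have := cappedGap_nonneg (K₀ := K₀) ha.optimal (mul_nonneg (by norm_num : (0 : ℝ) ≤ 10) hgap) K
        gcongr
        have : 0 < η * μ := by positivity
        linarith
      · rw [drift_of_notMem hK, cappedGap, if_neg hK, one_mul]
        exact le_add_of_nonneg_right (by positivity)

/-- The expected gap on the bounded set contracts. -/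
lemma Admissible.integral_cappedGap_le [IsProbabilityMeasure P]
    (ha : Admissible sys ν Cn K₀ Kstar φ L ρ μ ε η r) (hs : IsSampling P ν x u)
    (hημ : η * μ ≤ 2) (t : ℕ) :
    ∫ ω, cappedGap sys ν K₀ Kstar 0 (stoppedIterate sys ν K₀ Kstar η r
        (fun s => x s ω) (fun s => u s ω) t) ∂P ≤
      (1 - η * μ / 2) ^ t * initGap sys ν K₀ Kstar + ε / 60 := by
  have h := ha.standardized
  have := h.isProbabilityMeasure
  have := isProbabilityMeasure_unifSphere ha.n_pos ha.m_pos
  have hgap := initGap_nonneg ha.optimal ha.mem_finiteCost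
  have hμ := ha.curvature.μ_pos
  have hη := ha.η_pos
  have hε := ha.ε_pos
  induction t with
  | zero =>
    have h0 : cappedGap sys ν K₀ Kstar 0 K₀ = initGap sys ν K₀ Kstar :=
      if_pos (mem_boundedSet_self ha.optimal ha.mem_finiteCost)
    simp only [drivenProcess, h0, integral_const, probReal_univ, one_smul, pow_zero, one_mul]
    linarith
  | succ t ih =>
    have h1 := hs.integral_drivenProcess_le
      (measurable_stoppedStep (sys := sys) (K₀ := K₀) (Kstar := Kstar) (η := η) (r := r) h) K₀
      (measurable_cappedGap (sys := sys) (K₀ := K₀) (Kstar := Kstar) h 0)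
      (abs_cappedGap_le ha.optimal le_rfl (by positivity))
      (α := 1 - η * μ / 2) (b := η * μ * ε / 120) (fun K => ?_) t
    -- The term `ε / 60` is the fixed point of `y ↦ (1 - ημ/2) y + ημε/120`.
    · have h2 : 0 ≤ 1 - η * μ / 2 := by linarith
      have h3 := mul_le_mul_of_nonneg_left ih h2
      rw [pow_succ']
      linarith
    · by_cases hK : K ∈ boundedSet sys ν K₀ Kstar
      · exact ha.drift_of_mem hK le_rfl (by positivity)
      · rw [drift_of_notMem hK, cappedGap, if_neg hK, mul_zero, zero_add]
        positivity

/-- The set of policies in the bounded set of gap at most `ε`. -/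
def goodSet (sys : System n m) (ν : Measure (State n)) (K₀ Kstar : Policy n m) (ε : ℝ) :
    Set (Policy n m) :=
  {K | K ∈ boundedSet sys ν K₀ Kstar ∧ J sys ν K - J sys ν Kstar ≤ ε}

lemma measurableSet_goodSet (h : IsStandardized ν Cn) :
    MeasurableSet (goodSet sys ν K₀ Kstar ε) := by
  have := h.isProbabilityMeasure
  exact (isCompact_boundedSet h).measurableSet.inter
    (measurableSet_le (measurable_J.sub measurable_const) measurable_const)

/-- Markov's inequality for both capped gaps at once: outside the bounded set the first quotient
equals `1`, inside it with gap above `ε` the second is at least `1`. -/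
lemma Admissible.prob_notMem_goodSet_le [IsProbabilityMeasure P]
    (ha : Admissible sys ν Cn K₀ Kstar φ L ρ μ ε η r) (hs : IsSampling P ν x u)
    (hημ : η * μ ≤ 2) (hgap : 0 < initGap sys ν K₀ Kstar) (t : ℕ) :
    P.real {ω | stoppedIterate sys ν K₀ Kstar η r (fun s => x s ω) (fun s => u s ω) t ∉
        goodSet sys ν K₀ Kstar ε} ≤
      (initGap sys ν K₀ Kstar + η * μ * ε / 120 * t) / (10 * initGap sys ν K₀ Kstar) +
        ((1 - η * μ / 2) ^ t * initGap sys ν K₀ Kstar + ε / 60) / ε := by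
  have h := ha.standardized
  have hε := ha.ε_pos
  set Δ := initGap sys ν K₀ Kstar with hΔ
  set Z : Ω → Policy n m := fun ω =>
    stoppedIterate sys ν K₀ Kstar η r (fun s => x s ω) (fun s => u s ω) t with hZ
  have hZm : Measurable Z := hs.measurable_drivenProcess (measurable_stoppedStep h) K₀ t
  have hint : ∀ c, 0 ≤ c → c ≤ 10 * Δ → Integrable (fun ω => cappedGap sys ν K₀ Kstar c (Z ω)) P :=
    fun c hc hc' => Integrable.of_bound (C := 10 * Δ)
      ((measurable_cappedGap h c).comp hZm).aestronglyMeasurable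
      (Filter.Eventually.of_forall fun ω => abs_cappedGap_le ha.optimal hc hc' _)
  have hi1 := (hint (10 * Δ) (by positivity) le_rfl).div_const (10 * Δ)
  have hi2 := (hint 0 le_rfl (by positivity)).div_const ε
  have hmeas : MeasurableSet {ω | Z ω ∉ goodSet sys ν K₀ Kstar ε} :=
    hZm (measurableSet_goodSet h).compl
  calc P.real {ω | Z ω ∉ goodSet sys ν K₀ Kstar ε}
      = ∫ ω, {ω | Z ω ∉ goodSet sys ν K₀ Kstar ε}.indicator (fun _ => (1 : ℝ)) ω ∂P := by
        rw [integral_indicator hmeas]; simp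
    _ ≤ ∫ ω, (cappedGap sys ν K₀ Kstar (10 * Δ) (Z ω) / (10 * Δ) +
          cappedGap sys ν K₀ Kstar 0 (Z ω) / ε) ∂P := by
        refine integral_mono ((integrable_const (1 : ℝ)).indicator hmeas) (hi1.add hi2) fun ω => ?_
        have hn1 := cappedGap_nonneg (K₀ := K₀) ha.optimal
          (mul_nonneg (by norm_num : (0 : ℝ) ≤ 10) hgap.le) (Z ω)
        have hn2 := cappedGap_nonneg (K₀ := K₀) ha.optimal le_rfl (Z ω)
        by_cases hω : Z ω ∈ goodSet sys ν K₀ Kstar ε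
        · rw [Set.indicator_of_notMem (show ω ∉ {ω | Z ω ∉ goodSet sys ν K₀ Kstar ε} from not_not.2 hω)]
          positivity
        · rw [Set.indicator_of_mem (show ω ∈ {ω | Z ω ∉ goodSet sys ν K₀ Kstar ε} from hω)]
          by_cases hG : Z ω ∈ boundedSet sys ν K₀ Kstar
          · have hlt : ε < J sys ν (Z ω) - J sys ν Kstar := by
              by_contra hle
              exact hω ⟨hG, not_lt.1 hle⟩
            have h2 : cappedGap sys ν K₀ Kstar 0 (Z ω) = J sys ν (Z ω) - J sys ν Kstar := if_pos hG
            have h3 : 1 ≤ cappedGap sys ν K₀ Kstar 0 (Z ω) / ε := by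
              rw [one_le_div hε, h2]; exact hlt.le
            have h4 : 0 ≤ cappedGap sys ν K₀ Kstar (10 * Δ) (Z ω) / (10 * Δ) := by positivity
            linarith
          · have h2 : cappedGap sys ν K₀ Kstar (10 * Δ) (Z ω) = 10 * Δ := if_neg hG
            have h4 : 0 ≤ cappedGap sys ν K₀ Kstar 0 (Z ω) / ε := by positivity
            rw [h2, div_self (by positivity)]
            linarith
    _ = (∫ ω, cappedGap sys ν K₀ Kstar (10 * Δ) (Z ω) ∂P) / (10 * Δ) +
          (∫ ω, cappedGap sys ν K₀ Kstar 0 (Z ω) ∂P) / ε := by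
        rw [integral_add hi1 hi2, integral_div, integral_div]
    _ ≤ _ := by
        gcongr
        · exact ha.integral_cappedGap_exit_le hs t
        · exact ha.integral_cappedGap_le hs hημ t

/-- The stopped process never returns once outside, so ending inside means that it was never
stopped. -/
lemma iterate_eq_stoppedIterate {x : ℕ → State n} {u : ℕ → Policy n m} {T : ℕ}
    (hT : stoppedIterate sys ν K₀ Kstar η r x u T ∈ boundedSet sys ν K₀ Kstar) :
    ∀ t ≤ T, stoppedIterate sys ν K₀ Kstar η r x u t ∈ boundedSet sys ν K₀ Kstar ∧
      iterate sys η r K₀ x u t = stoppedIterate sys ν K₀ Kstar η r x u t := by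
  have hmem : ∀ t ≤ T, stoppedIterate sys ν K₀ Kstar η r x u t ∈ boundedSet sys ν K₀ Kstar := by
    intro t ht
    induction T, ht using Nat.le_induction with
    | base => exact hT
    | succ T _ ih =>
      refine ih ?_
      by_contra hT'
      have : stoppedIterate sys ν K₀ Kstar η r x u (T + 1) =
        stoppedIterate sys ν K₀ Kstar η r x u T := if_neg hT'
      exact hT' (this ▸ hT)
  intro t ht
  refine ⟨hmem t ht, ?_⟩
  induction t with
  | zero => rfl
  | succ t ih =>
    have h1 : stoppedIterate sys ν K₀ Kstar η r x u (t + 1) =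
        step sys η r (stoppedIterate sys ν K₀ Kstar η r x u t) (x t, u t) :=
      if_pos (hmem t (by omega))
    rw [h1, iterate, ih (by omega), step]

lemma Admissible.isSuccessfulRun (ha : Admissible sys ν Cn K₀ Kstar φ L ρ μ ε η r)
    {x : ℕ → State n} {u : ℕ → Policy n m} {T : ℕ}
    (hT : stoppedIterate sys ν K₀ Kstar η r x u T ∈ goodSet sys ν K₀ Kstar ε)
    (hu : ∀ t, ‖u t‖ = 1) : IsSuccessfulRun sys ν Kstar ε η r K₀ T x u := by
  have hit := iterate_eq_stoppedIterate hT.1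
  refine ⟨fun t ht => ?_, ?_, ?_⟩
  · obtain ⟨h1, h2⟩ := hit t ht.le
    rw [h2]
    have hrad := ha.radius
    rw [RadiusCondition, le_min_iff, le_min_iff, le_min_iff] at hrad
    exact sampleCost_ne_top ha.standardized (perturbed_bound (ha.curvature.lipschitz _ h1) ha.r_pos
      hrad.2.2.1 le_rfl (hu t)).1 _
  · rw [(hit T le_rfl).2]
    exact hT.1.1
  · rw [(hit T le_rfl).2]
    exact hT.2

lemma IsSampling.ae_norm_direction (hs : IsSampling P ν x u) (h : IsStandardized ν Cn)
    (hn : 0 < n) (hm : 0 < m) : ∀ᵐ ω ∂P, ∀ t, ‖u t ω‖ = 1 := by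
  refine ae_all_iff.2 fun t => ?_
  have h1 : ∀ᵐ p ∂(P.map fun ω => (x t ω, u t ω)), ‖p.2‖ = 1 := by
    rw [hs.law t]
    exact (ae_prod_bounded h hn hm).mono fun p hp => hp.2
  exact ae_of_ae_map (hs.measurable_sample t).aemeasurable h1

/-- Convergence of the one-point zero-order method with probability greater than `3 / 4`. -/
theorem Admissible.convergence [IsProbabilityMeasure P]
    (ha : Admissible sys ν Cn K₀ Kstar φ L ρ μ ε η r)
    (hlog : ε * Real.log (120 * initGap sys ν K₀ Kstar / ε) < 10 / 3 * initGap sys ν K₀ Kstar)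
    (hs : IsSampling P ν x u) :
    3 / 4 < P {ω | IsSuccessfulRun sys ν Kstar ε η r K₀
      (numSteps (initGap sys ν K₀ Kstar) μ ε η) (fun t => x t ω) (fun t => u t ω)} := by
  have h := ha.standardized
  have hε := ha.ε_pos
  have hη := ha.η_pos
  have hμ := ha.curvature.μ_pos
  have hφ := ha.curvature.φ_pos
  set Δ := initGap sys ν K₀ Kstar with hΔ
  have hgap : 0 < Δ := by
    rcases (initGap_nonneg ha.optimal ha.mem_finiteCost).eq_or_lt with h0 | h0
    · rw [← hΔ] at h0; simp [← h0] at hlog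
    · exact h0
  have hημ : η * μ ≤ 1 / 24000 := by
    have h1 := ha.step_size
    have hC48 : (0 : ℝ) < 1 / 48000 := by norm_num
    rw [StepSizeCondition, mul_min_of_nonneg _ _ hC48.le, mul_min_of_nonneg _ _ hC48.le,
      le_min_iff, le_min_iff] at h1
    calc η * μ ≤ 1 / 48000 * (1 / φ) * (2 * φ) := by
          gcongr
          · exact h1.2.1
          · exact ha.curvature.μ_le h ha.mem_finiteCost ha.optimal hgap
      _ = 1 / 24000 := by field_simp; norm_num
  set T := numSteps Δ μ ε η with hT
  have hsub : {ω | stoppedIterate sys ν K₀ Kstar η r (fun s => x s ω) (fun s => u s ω) T ∈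
      goodSet sys ν K₀ Kstar ε} ≤ᵐ[P] {ω | IsSuccessfulRun sys ν Kstar ε η r K₀ T
        (fun t => x t ω) (fun t => u t ω)} := by
    filter_upwards [hs.ae_norm_direction h ha.n_pos ha.m_pos] with ω hu hω
    exact ha.isSuccessfulRun hω hu
  refine lt_of_lt_of_le ?_ (measure_mono_ae hsub)
  have hmeas : MeasurableSet {ω | stoppedIterate sys ν K₀ Kstar η r (fun s => x s ω)
      (fun s => u s ω) T ∈ goodSet sys ν K₀ Kstar ε} :=
    hs.measurable_drivenProcess (measurable_stoppedStep h) K₀ T (measurableSet_goodSet h)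
  have hreal : 3 / 4 < P.real {ω | stoppedIterate sys ν K₀ Kstar η r (fun s => x s ω)
      (fun s => u s ω) T ∈ goodSet sys ν K₀ Kstar ε} := by
    -- If `120 Δ ≤ ε`, the logarithm is nonpositive, no step is taken, and `K₀` already succeeds.
    rcases le_or_gt (120 * Δ) ε with hsmall | hlarge
    · have hT0 : T = 0 := by
        rw [hT, numSteps, Nat.ceil_eq_zero]
        refine mul_nonpos_of_nonneg_of_nonpos (by positivity) ?_
        exact Real.log_nonpos (by positivity) ((div_le_one hε).2 hsmall)
      have huniv : {ω | stoppedIterate sys ν K₀ Kstar η r (fun s => x s ω)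
          (fun s => u s ω) T ∈ goodSet sys ν K₀ Kstar ε} = Set.univ := by
        refine Set.eq_univ_of_forall fun ω => ?_
        rw [hT0]
        refine ⟨mem_boundedSet_self ha.optimal ha.mem_finiteCost, ?_⟩
        have : J sys ν K₀ - J sys ν Kstar = Δ := rfl
        change J sys ν K₀ - J sys ν Kstar ≤ ε
        linarith
      rw [huniv, probReal_univ]
      norm_num
    · have hbad := ha.prob_notMem_goodSet_le hs (by linarith) hgap T
      rw [← hΔ] at hbad
      have hcompl := probReal_compl_eq_one_sub (μ := P) hmeas
      have heq : {ω | stoppedIterate sys ν K₀ Kstar η r (fun s => x s ω) (fun s => u s ω) T ∉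
          goodSet sys ν K₀ Kstar ε} = {ω | stoppedIterate sys ν K₀ Kstar η r (fun s => x s ω)
          (fun s => u s ω) T ∈ goodSet sys ν K₀ Kstar ε}ᶜ := rfl
      rw [heq, hcompl] at hbad
      set l := Real.log (120 * Δ / ε) with hl
      have hl0 : 0 < l := Real.log_pos ((one_lt_div hε).2 hlarge)
      have hT1 : (T : ℝ) ≤ 4 / (η * μ) * l + 1 := (Nat.ceil_lt_add_one (by positivity)).le
      have hT2 : 4 / (η * μ) * l ≤ T := Nat.le_ceil _
      have hημ0 : 0 < η * μ := by positivity
      -- The hypothesis on `ε` bounds `ε l / 30` by `Δ / 9`, and rounding up costs at most `Δ /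
      -- 24000`; the sum with `Δ` is below `3Δ/2`.
      have h1 : (Δ + η * μ * ε / 120 * T) / (10 * Δ) ≤ 3 / 20 := by
        rw [div_le_iff₀ (by positivity)]
        have h2 : η * μ * ε / 120 * T ≤ η * μ * ε / 120 * (4 / (η * μ) * l + 1) := by gcongr
        have h3 : η * μ * ε / 120 * (4 / (η * μ) * l + 1) = ε * l / 30 + η * μ * (ε / 120) := by
          field_simp; ring
        have h4 : η * μ * (ε / 120) ≤ 1 / 24000 * Δ :=
          mul_le_mul hημ (by linarith) (by positivity) (by norm_num)
        linarith
      -- The power contributes at most `ε / 120` and the stationary error is `ε / 60`, together `ε /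
      -- 40`.
      have h2 : ((1 - η * μ / 2) ^ T * Δ + ε / 60) / ε ≤ 1 / 40 := by
        have h3 : (1 - η * μ / 2) ^ T ≤ ε / (120 * Δ) := by
          calc (1 - η * μ / 2) ^ T ≤ Real.exp (-(η * μ / 2)) ^ T := by
                gcongr
                · linarith
                · have := Real.add_one_le_exp (-(η * μ / 2)); linarith
            _ = Real.exp (-(η * μ / 2 * T)) := by rw [← Real.exp_nat_mul]; ring_nf
            _ ≤ Real.exp (-l) := by
                gcongr
                calc l ≤ 2 * l := by linarith
                  _ = η * μ / 2 * (4 / (η * μ) * l) := by field_simp; norm_num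
                  _ ≤ _ := by gcongr
            _ = ε / (120 * Δ) := by
                rw [Real.exp_neg, hl, Real.exp_log (by positivity), inv_div]
        rw [div_le_iff₀ hε]
        have h4 : (1 - η * μ / 2) ^ T * Δ ≤ ε / (120 * Δ) * Δ := by gcongr
        have h5 : ε / (120 * Δ) * Δ = ε / 120 := by field_simp
        linarith
      linarith
  have h34 : (3 / 4 : ENNReal) = ENNReal.ofReal (3 / 4) := by
    rw [ENNReal.ofReal_div_of_pos (by norm_num)]; simp
  rw [h34, ENNReal.ofReal_lt_iff_lt_toReal (by norm_num) (measure_ne_top _ _)]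
  exact hreal

end Convergence

/-! ### Order of the number of rollouts -/

section Rollouts
variable {sys : System n m} {ν : Measure (State n)} {Cn : ℝ} {K₀ Kstar : Policy n m}
  {φ L ρ μ : ℝ}

/-- Radii of order `√ε` and step sizes of order `ε ^ 2` are admissible, and the resulting number of
rollouts is of order `ε⁻² log (120 Δ₀ / ε)`. -/
theorem exists_rollout_bound {C D c₀ Δ : ℝ} (hC : 0 < C) (hD : 0 < D) (hCn : 0 < Cn)
    (hc₀ : 0 < c₀) (hφ : 0 < φ) (hL : 0 < L) (hρ : 0 < ρ) (hμ : 0 < μ) (hΔ : 0 ≤ Δ) :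
    ∃ a b M : ℝ, 0 < a ∧ 0 < b ∧ 0 < M ∧ ∀ ε : ℝ, 0 < ε → ε ≤ Δ →
      StepSizeCondition C D Cn c₀ φ ρ μ ε (a * √ε) (b * ε ^ 2) ∧
      RadiusCondition c₀ φ L ρ μ ε (a * √ε) ∧
      (numSteps Δ μ ε (b * ε ^ 2) : ℝ) ≤ M * ε⁻¹ ^ 2 * Real.log (120 * Δ / ε) := by
  have hθ : 0 < curvatureFunctional φ L ρ := lt_min (by positivity) (by positivity)
  set θ := curvatureFunctional φ L ρ with hθdef
  rcases hΔ.eq_or_lt with rfl | hΔ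
  · exact ⟨1, 1, 1, one_pos, one_pos, one_pos, fun ε h1 h2 => absurd h2 (not_le.2 h1)⟩
  have hsΔ : 0 < √Δ := Real.sqrt_pos.2 hΔ
  -- Bounds that do not scale like `√ε` are divided by `√Δ`, since `√ε ≤ √Δ`; likewise for `b` with
  -- `ε ^ 2`.
  obtain ⟨a, ha0, ha⟩ : ∃ a, 0 < a ∧ a ≤ min (min (θ * μ / (8 * φ) * √(1 / 15))
      (1 / (2 * φ) * √(μ / 30))) (min (ρ / √Δ) (10 * c₀ / L / √Δ)) :=
    ⟨_, by positivity, le_rfl⟩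
  obtain ⟨b, hb0, hb⟩ : ∃ b, 0 < b ∧ b ≤ min (C * (μ * a ^ 2 / (φ * Cn ^ 2 * D ^ 2 * c₀ ^ 2)))
      (min (C * (1 / φ) / Δ ^ 2) (C * (ρ * a / (Cn * D * c₀)) / (Δ * √Δ))) :=
    ⟨_, by positivity, le_rfl⟩
  simp only [le_min_iff] at ha hb
  obtain ⟨⟨ha1, ha2⟩, ha3, ha4⟩ := ha
  obtain ⟨hb1, hb2, hb3⟩ := hb
  -- The summand `Δ ^ 2` absorbs the `1` from rounding up, as `Δ² ε⁻² ≥ 1` and the logarithm is at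
  -- least `1`.
  refine ⟨a, b, 4 / (b * μ) + Δ ^ 2, ha0, hb0, by positivity, fun ε hε hεΔ => ?_⟩
  have hsε : √ε ≤ √Δ := Real.sqrt_le_sqrt hεΔ
  have hsq : √ε ^ 2 = ε := Real.sq_sqrt hε.le
  have hsε0 : 0 < √ε := Real.sqrt_pos.2 hε
  refine ⟨?_, ?_, ?_⟩
  · rw [StepSizeCondition, mul_min_of_nonneg _ _ hC.le, mul_min_of_nonneg _ _ hC.le]
    refine le_min ?_ (le_min ?_ ?_)
    · calc b * ε ^ 2 ≤ C * (μ * a ^ 2 / (φ * Cn ^ 2 * D ^ 2 * c₀ ^ 2)) * ε ^ 2 := by gcongr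
        _ = _ := by rw [mul_pow, hsq]; ring
    · calc b * ε ^ 2 ≤ C * (1 / φ) / Δ ^ 2 * Δ ^ 2 := by gcongr
        _ = _ := by field_simp
    · calc b * ε ^ 2 = b * (ε * √ε) * √ε := by
            rw [mul_assoc, mul_assoc, ← sq (√ε), hsq, sq]
        _ ≤ C * (ρ * a / (Cn * D * c₀)) / (Δ * √Δ) * (Δ * √Δ) * √ε := by gcongr
        _ = _ := by field_simp
  · refine le_min ?_ (le_min ?_ (le_min ?_ ?_))
    · calc a * √ε ≤ θ * μ / (8 * φ) * √(1 / 15) * √ε := by gcongr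
        _ = θ * μ / (8 * φ) * √(ε / 15) := by
          rw [mul_assoc, ← Real.sqrt_mul (by norm_num)]; congr 2; ring
    · calc a * √ε ≤ 1 / (2 * φ) * √(μ / 30) * √ε := by gcongr
        _ = 1 / (2 * φ) * √(ε * μ / 30) := by
          rw [mul_assoc, ← Real.sqrt_mul (by positivity)]; congr 2; ring
    · calc a * √ε ≤ ρ / √Δ * √Δ := by gcongr
        _ = ρ := by field_simp
    · calc a * √ε ≤ 10 * c₀ / L / √Δ * √Δ := by gcongr
        _ = 10 * c₀ / L := by field_simp
  · have hlog : 1 ≤ Real.log (120 * Δ / ε) := by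
      rw [Real.le_log_iff_exp_le (by positivity)]
      refine Real.exp_one_lt_d9.le.trans ?_
      rw [le_div_iff₀ hε]
      linarith
    set l := Real.log (120 * Δ / ε)
    have hceil : (numSteps Δ μ ε (b * ε ^ 2) : ℝ) ≤ 4 / (b * ε ^ 2 * μ) * l + 1 :=
      (Nat.ceil_lt_add_one (by positivity)).le
    have hone : 1 ≤ Δ ^ 2 * ε⁻¹ ^ 2 := by
      rw [← mul_pow, ← div_eq_mul_inv]
      exact one_le_pow₀ ((one_le_div hε).2 hεΔ)
    calc _ ≤ 4 / (b * ε ^ 2 * μ) * l + 1 := hceil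
      _ ≤ 4 / (b * ε ^ 2 * μ) * l + Δ ^ 2 * ε⁻¹ ^ 2 * l := by
          gcongr
          exact one_le_mul_of_one_le_of_one_le hone hlog
      _ = _ := by field_simp

end Rollouts

end LQR
end

theorem corollary1 :
    ∃ C : ℝ, 0 < C ∧
    ∀ (n m : ℕ), 0 < n → 0 < m →
    ∀ (sys : LQR.System n m) (ν : Measure (LQR.State n)) (Cn : ℝ), LQR.IsStandardized ν Cn →
    ∀ K₀ : LQR.Policy n m, K₀ ∈ LQR.finiteCost sys ν →
      -- the problem is well posed: smooth cost on an open domain, and a global minimum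
      (IsOpen (LQR.finiteCost sys ν) ∧
        ContDiffOn ℝ 1 (LQR.J sys ν) (LQR.finiteCost sys ν) ∧
        ∃ Kstar : LQR.Policy n m, LQR.IsOptimal sys ν Kstar) ∧
      ∀ Kstar : LQR.Policy n m, LQR.IsOptimal sys ν Kstar →
        -- finite and positive curvature parameters exist
        (∃ φ L ρ μ : ℝ, LQR.IsCurvature sys ν K₀ Kstar φ L ρ μ) ∧
        ∀ φ L ρ μ : ℝ, LQR.IsCurvature sys ν K₀ Kstar φ L ρ μ →
          -- convergence for all admissible step sizes and smoothing radii
          (∀ ε η r : ℝ, 0 < ε → 0 < η → 0 < r →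
            LQR.StepSizeCondition C ((n * m : ℕ) : ℝ) Cn (LQR.J sys ν K₀) φ ρ μ ε r η →
            LQR.RadiusCondition (LQR.J sys ν K₀) φ L ρ μ ε r →
            ε * Real.log (120 * LQR.initGap sys ν K₀ Kstar / ε)
              < 10 / 3 * LQR.initGap sys ν K₀ Kstar →
            ∀ {Ω : Type*} [MeasurableSpace Ω] (P : Measure Ω) [IsProbabilityMeasure P]
              (x : ℕ → Ω → LQR.State n) (u : ℕ → Ω → LQR.Policy n m),
              LQR.IsSampling P ν x u →
              3 / 4 < P {ω | LQR.IsSuccessfulRun sys ν Kstar ε η r K₀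
                (LQR.numSteps (LQR.initGap sys ν K₀ Kstar) μ ε η)
                (fun t => x t ω) (fun t => u t ω)}) ∧
          -- radii of order `√ε` and step sizes of order `ε ^ 2` are admissible, and then the
          -- number of rollouts is of order `ε⁻² log (120 Δ₀ / ε)`
          (∃ a b M : ℝ, 0 < a ∧ 0 < b ∧ 0 < M ∧
            ∀ ε : ℝ, 0 < ε → ε ≤ LQR.initGap sys ν K₀ Kstar →
              LQR.StepSizeCondition C ((n * m : ℕ) : ℝ) Cn (LQR.J sys ν K₀) φ ρ μ ε
                (a * √ε) (b * ε ^ 2) ∧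
              LQR.RadiusCondition (LQR.J sys ν K₀) φ L ρ μ ε (a * √ε) ∧
              (LQR.numSteps (LQR.initGap sys ν K₀ Kstar) μ ε (b * ε ^ 2) : ℝ)
                ≤ M * ε⁻¹ ^ 2 * Real.log (120 * LQR.initGap sys ν K₀ Kstar / ε)) := by
  refine ⟨1 / 48000, by norm_num, ?_⟩
  intro n m hn hm sys ν Cn h K₀ hK₀
  refine ⟨⟨LQR.isOpen_finiteCost h, (LQR.contDiffOn_J h).of_le (by norm_num),
    LQR.exists_isOptimal h hK₀⟩, fun Kstar hopt => ⟨LQR.exists_isCurvature h hK₀ hopt, ?_⟩⟩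
  intro φ L ρ μ hcurv
  have hb := hcurv.bounds hK₀ hopt
  refine ⟨?_, ?_⟩
  · intro ε η r hε hη hr hstep hrad hlog Ω _ P _ x u hs
    have ha : LQR.Admissible sys ν Cn K₀ Kstar φ L ρ μ ε η r :=
      ⟨hn, hm, h, hK₀, hopt, hb, hε, hη, hr, hstep, hrad⟩
    exact ha.convergence hlog hs
  · exact LQR.exists_rollout_bound (by norm_num) (by exact_mod_cast Nat.mul_pos hn hm)
      (h.Cn_pos hn) (LQR.J_pos h hn hK₀) hb.φ_pos hb.L_pos hb.ρ_pos hb.μ_pos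
      (LQR.initGap_nonneg hopt hK₀)
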